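/- Let $(X,d,\mu)$ be a space of homogeneous type: $d$ is a quasi-distance on $X$ whose balls are measurable, $\mu$ is a doubling measure giving positive finite mass to each ball, and each measurable set differs from a Borel set by a $\mu$-null set. Let $\mathcal D=\bigcup_{j\in\mathbb Z}\mathcal D^j$ be a dyadic family of measurable sets (cubes) as constructed by Christ: for each $j$ the cubes of $\mathcal D^j$ are pairwise disjoint and cover $X$ up to a $\mu$-null set; a cube of $\mathcal D^j$ is contained in or disjoint from any given cube of $\mathcal D^i$ when $i\le j$; and there are $0<\Lambda<1$ and $a_1,a_2>0$ such that each $Q\in\mathcal D^j$ satisfies $B(x,a_1\Lambda^j)\subseteq Q\subseteq B(x,a_2\Lambda^j)$ for some $x\in Q$. Assume that any two cubes have a common ancestor. For $Q\in\mathcal D^j$ the children of $Q$ are the cubes of $\mathcal D^{j+1}$ contained in $Q$. Let $\mathscr H$ be a Haar system associated with $\mathcal D$: each $h\in\mathscr H$ is a real measurable function of mean zero based on a cube $Q(h)$, that is, it vanishes off $Q(h)$ and is constant on each child of $Q(h)$; and for each $Q\in\mathcal D$ the functions $h\in\mathscr H$ based on $Q$ are orthonormal in $L^2(X,\mu)$,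 their number being the number of children of $Q$ minus one. Set $\delta(x,y)=\min\{\mu(Q):Q\in\mathcal D,\ x,y\in Q\}$ for $x\ne y$ (for $\mu$-almost every $x$ and $y$) and $\delta(x,x)=0$. For $\sigma>0$ let $B^\sigma_2=B^\sigma_2(X,\delta,\mu)$ be the space of the complex-valued $f\in L^2(X,\mu)$ with $$\|f\|_{B^\sigma_2}^2=\|f\|_{L^2}^2+\iint_{X\times X}\frac{|f(x)-f(y)|^2}{\delta(x,y)^{1+2\sigma}}\,d\mu(x)\,d\mu(y)<\infty,$$ and for $0<\beta<1$ let $$D^\beta f(x)=\int_X\frac{f(x)-f(y)}{\delta(x,y)^{1+\beta}}\,d\mu(y),$$ where $D^\beta f=g$ means that for almost every $x$ the integral converges absolutely and equals $g(x)$. (On the diagonal the integrands are read as $0$.) Let $P_0$ be the orthogonal projection of $L^2(X,\mu)$ onto the subspace $V_0$ of the functions that are constant on each cube $Q\in\mathcal D^0$. **Theorem.** Let $0<\beta<1$. There are real constants $m_h$, $h\in\mathscr H$, such that $D^\beta h=m_h\,\mu(Q(h))^{-\beta}h$ for every $h\in\mathscr H$, and $M_1<m_h<M_2$ for all $h$ with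 two positive finite constants $M_1,M_2$. Moreover, for every $\lambda$ with $\beta<\lambda<1$ and every $u_0\in B^\lambda_2$ with $P_0u_0=0$: (a) for every $t>0$ the series $$u(t)=\sum_{h\in\mathscr H}e^{-itm_h\mu(Q(h))^{-\beta}}\langle u_0,h\rangle h$$ converges (unconditionally) in $L^2(X,\mu)$ and its sum belongs to $B^\lambda_2$; (b) $u$ solves $$i\frac{du}{dt}=D^\beta u\quad(t>0),\qquad u(0)=u_0,$$ in the following sense: as a function of $t\in(0,\infty)$ with values in $B^{\lambda-\beta}_2$ (which contains each $u(t)$), $u$ has a Fréchet derivative $\frac{du}{dt}$, for each $t>0$ one has $D^\beta u(t)=i\frac{du}{dt}(t)$, and $\lim_{t\to0^+}u(t)=u_0$ in $B^\lambda_2$. -/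

import Mathlib

open MeasureTheory Filter Topology
open scoped NNReal ENNReal

noncomputable section

variable {X : Type*}

/-! ### Spaces of homogeneous type -/

/-- The ball of centre `x` and radius `r` of a quasi-distance `d`. -/
def quasiBall (d : X → X → ℝ) (x : X) (r : ℝ) : Set X := {y | d x y < r}

/-- The open sets of the topology induced by a quasi-distance `d`. -/
def IsQuasiOpen (d : X → X → ℝ) (s : Set X) : Prop :=
  ∀ x ∈ s, ∃ r : ℝ, 0 < r ∧ quasiBall d x r ⊆ s

/-- `(X, d, μ)` is a space of homogeneous type: `d` is a quasi-distance, the balls are measurable,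
`μ` is doubling, and every measurable set agrees up to a `μ`-null set with a Borel set
(automatic if the measurable sets are the Borel sets, or the sets of their `μ`-completion). -/
structure IsHomogeneousType [MeasurableSpace X] (d : X → X → ℝ) (μ : Measure X) : Prop where
  dist_nonneg : ∀ x y, 0 ≤ d x y
  dist_eq_zero : ∀ x y, d x y = 0 ↔ x = y
  dist_symm : ∀ x y, d x y = d y x
  dist_triangle : ∃ K : ℝ, ∀ x y z, d x z ≤ K * (d x y + d y z)
  measurableSet_ball : ∀ x r, MeasurableSet (quasiBall d x r)
  doubling : ∃ A : ℝ≥0, ∀ x, ∀ r : ℝ, 0 < r →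
    0 < μ (quasiBall d x r) ∧ μ (quasiBall d x r) < ∞ ∧
      μ (quasiBall d x (2 * r)) ≤ A * μ (quasiBall d x r)
  borel_regular : ∀ s, MeasurableSet s →
    ∃ t, MeasurableSet[MeasurableSpace.generateFrom {o | IsQuasiOpen d o}] t ∧ s =ᵐ[μ] t

/-! ### Dyadic families -/

/-- `D j` is the family of the dyadic cubes of scale `j`. (Existence and uniqueness of the ancestor
of a cube at each coarser scale follow from the fields below.) -/
structure IsDyadicFamily [MeasurableSpace X] (d : X → X → ℝ) (μ : Measure X)
    (D : ℤ → Set (Set X)) : Prop where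
  measurableSet : ∀ j, ∀ Q ∈ D j, MeasurableSet Q
  pairwiseDisjoint : ∀ j, (D j).PairwiseDisjoint id
  ae_cover : ∀ j, μ (⋃₀ D j)ᶜ = 0
  nested : ∀ i j, i ≤ j → ∀ Q ∈ D j, ∀ P ∈ D i, Q ⊆ P ∨ Disjoint Q P
  size : ∃ Λ a₁ a₂ : ℝ, 0 < Λ ∧ Λ < 1 ∧ 0 < a₁ ∧ 0 < a₂ ∧ ∀ j, ∀ Q ∈ D j,
    ∃ x ∈ Q, quasiBall d x (a₁ * Λ ^ j) ⊆ Q ∧ Q ⊆ quasiBall d x (a₂ * Λ ^ j)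

/-- `X` itself is a quadrant: any two cubes have a common ancestor. -/
def IsQuadrant (D : ℤ → Set (Set X)) : Prop :=
  ∀ i j, ∀ P ∈ D i, ∀ Q ∈ D j, ∃ k, ∃ R ∈ D k, P ⊆ R ∧ Q ⊆ R

/-- The offspring of a cube `Q` of scale `j`. -/
def offspring (D : ℤ → Set (Set X)) (j : ℤ) (Q : Set X) : Set (Set X) := {P ∈ D (j + 1) | P ⊆ Q}

open Classical in
/-- The dyadic distance: the smallest measure of a cube that contains both points. -/
def dyadicDist [MeasurableSpace X] (D : ℤ → Set (Set X)) (μ : Measure X) (x y : X) : ℝ :=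
  if x = y then 0 else sInf {r | ∃ j, ∃ Q ∈ D j, x ∈ Q ∧ y ∈ Q ∧ r = μ.real Q}

/-! ### Haar systems -/

/-- A Haar system associated with `D`, a set of real functions. The wavelet `h` is based on the cube
`cube h` of scale `scale h`: it vanishes off that cube and is constant on each of its children.
The wavelets based on `Q` form an orthonormal system of mean-zero functions, with one element less
than the number of children of `Q`; so together with `μ(Q)^{-1/2} χ_Q` they are an orthonormal basis
of the functions on `Q` that are constant on each child of `Q`. -/
structure HaarSystem [MeasurableSpace X] (D : ℤ → Set (Set X)) (μ : Measure X) where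
  carrier : Set (X → ℝ)
  scale : carrier → ℤ
  cube : carrier → Set X
  cube_mem : ∀ h, cube h ∈ D (scale h)
  measurable : ∀ h : carrier, Measurable h.1
  eq_zero : ∀ h : carrier, ∀ x ∉ cube h, h.1 x = 0
  const_on_offspring : ∀ h : carrier, ∀ P ∈ offspring D (scale h) (cube h),
    ∃ c : ℝ, ∀ x ∈ P, h.1 x = c
  integral_eq_zero : ∀ h : carrier, ∫ x, h.1 x ∂μ = 0
  integral_sq : ∀ h : carrier, ∫ x, h.1 x ^ 2 ∂μ = 1
  orthogonal : ∀ h k : carrier, scale h = scale k → cube h = cube k → h ≠ k →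
    ∫ x, h.1 x * k.1 x ∂μ = 0
  card_based : ∀ j, ∀ Q ∈ D j,
    {h | scale h = j ∧ cube h = Q}.encard + 1 = (offspring D j Q).encard

lemma HaarSystem.memLp [MeasurableSpace X] {D : ℤ → Set (Set X)} {μ : Measure X}
    (H : HaarSystem D μ) (h : H.carrier) : MemLp (fun x => (h.1 x : ℂ)) 2 μ := by
  have hi : Integrable (fun x => h.1 x ^ 2) μ := by
    by_contra hn
    have h1 := H.integral_sq h
    rw [integral_undef hn] at h1
    exact zero_ne_one h1
  exact ((memLp_two_iff_integrable_sq (H.measurable h).aestronglyMeasurable).2 hi).ofReal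

/-- The class in `L²` of a Haar wavelet. -/
def HaarSystem.toL2 [MeasurableSpace X] {D : ℤ → Set (Set X)} {μ : Measure X}
    (H : HaarSystem D μ) (h : H.carrier) : Lp ℂ 2 μ := (H.memLp h).toLp _

/-! ### The space `V_j` of the functions that are constant on the cubes of scale `j` -/

/-- The subspace `V_j` of `L²` of the functions that are constant on each cube of scale `j`. -/
def dyadicConst [MeasurableSpace X] (D : ℤ → Set (Set X)) (μ : Measure X) (j : ℤ) :
    Submodule ℂ (Lp ℂ 2 μ) where
  carrier := {f | ∀ Q ∈ D j, ∃ c : ℂ, ∀ᵐ x ∂μ.restrict Q, f x = c}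
  zero_mem' := fun Q _ => ⟨0, ae_restrict_of_ae (Lp.coeFn_zero ℂ 2 μ)⟩
  add_mem' := by
    intro f g hf hg Q hQ
    obtain ⟨a, ha⟩ := hf Q hQ
    obtain ⟨b, hb⟩ := hg Q hQ
    refine ⟨a + b, ?_⟩
    filter_upwards [ha, hb, ae_restrict_of_ae (Lp.coeFn_add f g)] with x h1 h2 h3
    rw [h3, Pi.add_apply, h1, h2]
  smul_mem' := by
    intro c f hf Q hQ
    obtain ⟨a, ha⟩ := hf Q hQ
    refine ⟨c * a, ?_⟩
    filter_upwards [ha, ae_restrict_of_ae (Lp.coeFn_smul c f)] with x h1 h3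
    rw [h3, Pi.smul_apply, h1, smul_eq_mul]

/-! ### The fractional derivative -/

/-- `D^β f = g`: for almost every `x` the integral that defines `D^β f(x)` converges absolutely and
its value is `g(x)`. -/
def HasFracDeriv [MeasurableSpace X] (D : ℤ → Set (Set X)) (μ : Measure X) (β : ℝ)
    (f g : X → ℂ) : Prop :=
  ∀ᵐ x ∂μ,
    Integrable (fun y => (f x - f y) / ((dyadicDist D μ x y ^ (1 + β) : ℝ) : ℂ)) μ ∧
    ∫ y, (f x - f y) / ((dyadicDist D μ x y ^ (1 + β) : ℝ) : ℂ) ∂μ = g x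

/-! ### The Besov spaces -/

/-- The quotient `(f(x) - f(y)) / δ(x,y)^{(1+2σ)/2}`, the square of whose modulus is
`|f(x) - f(y)|² / δ(x,y)^{1+2σ}`. -/
def besovQuotient [MeasurableSpace X] (D : ℤ → Set (Set X)) (μ : Measure X) (σ : ℝ)
    (f : X → ℂ) (p : X × X) : ℂ :=
  (f p.1 - f p.2) / ((dyadicDist D μ p.1 p.2 ^ ((1 + 2 * σ) / 2) : ℝ) : ℂ)

section Besov

variable [MeasurableSpace X] (D : ℤ → Set (Set X)) (μ : Measure X) (σ : ℝ)

lemma besovQuotient_add (f g : Lp ℂ 2 μ) :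
    besovQuotient D μ σ (f + g : Lp ℂ 2 μ) =ᵐ[μ.prod μ]
      besovQuotient D μ σ f + besovQuotient D μ σ g := by
  have h := Lp.coeFn_add f g
  filter_upwards [Measure.quasiMeasurePreserving_fst.ae h,
    Measure.quasiMeasurePreserving_snd.ae h] with p h1 h2
  simp only [besovQuotient, Pi.add_apply] at *
  rw [h1, h2]
  ring

lemma besovQuotient_smul (c : ℂ) (f : Lp ℂ 2 μ) :
    besovQuotient D μ σ (c • f : Lp ℂ 2 μ) =ᵐ[μ.prod μ] c • besovQuotient D μ σ f := by
  have h := Lp.coeFn_smul c f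
  filter_upwards [Measure.quasiMeasurePreserving_fst.ae h,
    Measure.quasiMeasurePreserving_snd.ae h] with p h1 h2
  simp only [besovQuotient, Pi.smul_apply, smul_eq_mul] at *
  rw [h1, h2]
  ring

lemma besovQuotient_zero :
    besovQuotient D μ σ (0 : Lp ℂ 2 μ) =ᵐ[μ.prod μ] (0 : X × X → ℂ) := by
  have h := besovQuotient_smul D μ σ 0 0
  rwa [zero_smul, zero_smul] at h

/-- The functions `f ∈ L²` with `∬ |f(x) - f(y)|² / δ(x,y)^{1+2σ} dμ(x) dμ(y) < ∞`. -/
def besovSubmodule : Submodule ℂ (Lp ℂ 2 μ) where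
  carrier := {f | MemLp (besovQuotient D μ σ f) 2 (μ.prod μ)}
  zero_mem' := (memLp_congr_ae (besovQuotient_zero D μ σ)).2 MemLp.zero
  add_mem' := fun {f g} hf hg =>
    (memLp_congr_ae (besovQuotient_add D μ σ f g)).2 (MemLp.add hf hg)
  smul_mem' := fun c f hf =>
    (memLp_congr_ae (besovQuotient_smul D μ σ c f)).2 (MemLp.const_smul hf c)

/-- The Besov space `B^σ_2(X, δ, μ)`. -/
def Besov : Type _ := besovSubmodule D μ σ

instance : AddCommGroup (Besov D μ σ) := inferInstanceAs (AddCommGroup (besovSubmodule D μ σ))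

instance : Module ℂ (Besov D μ σ) := inferInstanceAs (Module ℂ (besovSubmodule D μ σ))

variable {D μ σ}

/-- An element of the Besov space as an element of `L²`. -/
def Besov.toL2 (f : Besov D μ σ) : Lp ℂ 2 μ := f.1

variable (D μ σ)

/-- The pair of `f` and its quotient `(f(x) - f(y)) / δ(x,y)^{(1+2σ)/2}`. -/
def besovEmbedding : Besov D μ σ →ₗ[ℂ] WithLp 2 (Lp ℂ 2 μ × Lp ℂ 2 (μ.prod μ)) where
  toFun f := WithLp.toLp 2 (f.1, MemLp.toLp _ f.2)
  map_add' f g := by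
    refine congrArg (WithLp.toLp 2) (Prod.ext rfl ?_)
    exact (MemLp.toLp_eq_toLp_iff (f + g).2 (MemLp.add f.2 g.2)).2
      (besovQuotient_add D μ σ f.1 g.1)
  map_smul' c f := by
    refine congrArg (WithLp.toLp 2) (Prod.ext rfl ?_)
    exact (MemLp.toLp_eq_toLp_iff (c • f).2 (MemLp.const_smul f.2 c)).2
      (besovQuotient_smul D μ σ c f.1)

lemma besovEmbedding_injective : Function.Injective (besovEmbedding D μ σ) := by
  intro f g h
  exact Subtype.ext (congrArg (fun z => (WithLp.ofLp z).1) h)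

/-- The norm of the Besov space is
`(‖f‖²_{L²} + ∬ |f(x) - f(y)|² / δ(x,y)^{1+2σ} dμ(x) dμ(y))^{1/2}`. -/
instance : NormedAddCommGroup (Besov D μ σ) :=
  NormedAddCommGroup.induced _ _ (besovEmbedding D μ σ) (besovEmbedding_injective D μ σ)

instance : NormedSpace ℂ (Besov D μ σ) := NormedSpace.induced ℂ _ _ (besovEmbedding D μ σ)

end Besov

end

/-!
The Haar system diagonalizes the problem. Let `h` be based on the cube `Q`. For `x ∈ Q` the
distance `δ(x,y)` equals `μ(Q)` for the `y ∈ Q` with `h(y) ≠ h(x)`, and for `y ∉ Q` it does not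
depend on `x ∈ Q`. Since `h` has mean zero it follows that `D^α h = ω h` for every `α > 0`, with
`ω = μ(Q)^(-α) + ∫_{X \ Q} δ(x,y)^(-1-α) dμ(y)` (`IsWavelet.integral_sub_mul_kernel`). The
`δ`-balls are increasing unions of cubes, whence `μ {y | δ(x,y) < s} ≤ s`; summing over dyadic
shells, the tail integral is at most a constant times `μ(Q)^(-α)` (`lintegral_tail_le`). So
`ω μ(Q)^α` lies between `1` and a constant.

The double integral in the norm of `B^σ_2` is the quadratic form of `D^{2σ}`. By Fubini and the
antisymmetry of `h(x) - h(y)`, the Haar system is orthogonal in `B^σ_2` as well, and the inner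
product in `B^σ_2` of `h` with any `f` is `1 + 2ω` times the one in `L²`, `ω` now being the
eigenvalue of order `2σ` (`HaarSystem.inner_besovEmbedding`). As `B^σ_2` is complete, a Haar
series converges in it if and only if its coefficients are square summable with the weights
`1 + 2ω`, which are comparable to `1 + μ(Q)^(-2σ)`. Bessel's inequality puts the coefficients
of `u₀`
in this weighted space, the phases `e^{-itω}` have modulus `1`, and dominated convergence for
orthogonal series gives the derivative in `B^{λ-β}_2` and the limit in `B^λ_2` as `t → 0`.

Two points remain. The series at time `0` is `u₀`: a function orthogonal to `V₀` and to the Haar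
system has integral zero over each cube of non-negative scale, since the wavelets based on `Q` and
`χ_Q` span the indicator functions of the children of `Q` by a dimension count; and these cubes
generate the measurable sets up to null sets (`HaarSystem.eq_zero_of_inner_eq_zero`). Finally,
`D^β` acts term by term on Haar series in `B^λ_2`, because for `β < λ` it is a closed operator
there: the Cauchy-Schwarz inequality bounds the integral of `|f(x) - f(y)| / δ(x,y)^(1+β)` over
`y` by `|f(x)|`, `‖f‖` and the square root of the inner integral of the Besov norm
(`isClosed_fracDerivGraph`).
-/

/-! ### Geometry of the dyadic cubes -/

section Geometry

variable {X : Type*} [MeasurableSpace X] {d : X → X → ℝ} {μ : Measure X} {D : ℤ → Set (Set X)}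

namespace IsDyadicFamily

lemma measure_pos (hX : IsHomogeneousType d μ) (hD : IsDyadicFamily d μ D) {j : ℤ} {Q : Set X}
    (hQ : Q ∈ D j) : 0 < μ Q := by
  obtain ⟨Λ, a₁, a₂, hΛ, -, h1, h2, h⟩ := hD.size
  obtain ⟨A, hA⟩ := hX.doubling
  obtain ⟨x, -, hx, -⟩ := h j Q hQ
  exact (hA x _ (by positivity)).1.trans_le (measure_mono hx)

lemma measure_lt_top (hX : IsHomogeneousType d μ) (hD : IsDyadicFamily d μ D) {j : ℤ} {Q : Set X}
    (hQ : Q ∈ D j) : μ Q < ∞ := by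
  obtain ⟨Λ, a₁, a₂, hΛ, -, h1, h2, h⟩ := hD.size
  obtain ⟨A, hA⟩ := hX.doubling
  obtain ⟨x, -, -, hx⟩ := h j Q hQ
  exact (measure_mono hx).trans_lt (hA x _ (by positivity)).2.1

lemma real_pos (hX : IsHomogeneousType d μ) (hD : IsDyadicFamily d μ D) {j : ℤ} {Q : Set X}
    (hQ : Q ∈ D j) : 0 < μ.real Q :=
  ENNReal.toReal_pos (hD.measure_pos hX hQ).ne' (hD.measure_lt_top hX hQ).ne

lemma eq_of_mem (hD : IsDyadicFamily d μ D) {j : ℤ} {P Q : Set X} (hP : P ∈ D j) (hQ : Q ∈ D j)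
    {x : X} (hxP : x ∈ P) (hxQ : x ∈ Q) : P = Q :=
  (hD.pairwiseDisjoint j).elim_set hP hQ x hxP hxQ

lemma subset_of_mem (hD : IsDyadicFamily d μ D) {i j : ℤ} (hij : i ≤ j) {P Q : Set X}
    (hQ : Q ∈ D j) (hP : P ∈ D i) {x : X} (hxQ : x ∈ Q) (hxP : x ∈ P) : Q ⊆ P :=
  (hD.nested i j hij Q hQ P hP).resolve_right fun h => Set.disjoint_left.1 h hxQ hxP

lemma exists_ancestor (hX : IsHomogeneousType d μ) (hD : IsDyadicFamily d μ D) {i j : ℤ}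
    (hij : i ≤ j) {Q : Set X} (hQ : Q ∈ D j) : ∃ P ∈ D i, Q ⊆ P := by
  have h : ¬ Q ⊆ (⋃₀ D i)ᶜ := fun h =>
    (hD.measure_pos hX hQ).ne' (measure_mono_null h (hD.ae_cover i))
  obtain ⟨x, hxQ, hx⟩ := Set.not_subset.1 h
  obtain ⟨P, hP, hxP⟩ := not_not.1 hx
  exact ⟨P, hP, hD.subset_of_mem hij hQ hP hxQ hxP⟩

lemma nonempty (hX : IsHomogeneousType d μ) (hD : IsDyadicFamily d μ D) {j : ℤ} {Q : Set X}
    (hQ : Q ∈ D j) : Q.Nonempty :=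
  nonempty_of_measure_ne_zero (hD.measure_pos hX hQ).ne'

/-- Almost every point lies in a cube of each scale. -/
lemma ae_forall_mem (hD : IsDyadicFamily d μ D) : ∀ᵐ x ∂μ, ∀ j, ∃ Q ∈ D j, x ∈ Q := by
  rw [ae_all_iff]
  intro j
  have := hD.ae_cover j
  rw [← mem_ae_iff] at this
  filter_upwards [this] with x hx using hx

/-- Since any two cubes have a common ancestor, the ancestors of a single cube exhaust `X` up to
a null set; so `μ` is `σ`-finite. -/
lemma sigmaFinite (hX : IsHomogeneousType d μ) (hD : IsDyadicFamily d μ D) (hq : IsQuadrant D) :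
    SigmaFinite μ := by
  rcases (D 0).eq_empty_or_nonempty with h0 | ⟨Q, hQ⟩
  · have h : μ Set.univ = 0 := by simpa [h0] using hD.ae_cover 0
    rw [Measure.measure_univ_eq_zero] at h
    rw [h]
    infer_instance
  · have hA : ∀ n : ℕ, ∃ P ∈ D (-n), Q ⊆ P := fun n => hD.exists_ancestor hX (by omega) hQ
    choose P hP hQP using hA
    refine ⟨⟨⟨fun n => P n ∪ (⋃₀ D 0)ᶜ, fun _ => trivial, fun n => ?_, ?_⟩⟩⟩
    · refine (measure_union_le _ _).trans_lt ?_
      rw [hD.ae_cover 0, add_zero]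
      exact hD.measure_lt_top hX (hP n)
    · refine Set.eq_univ_of_forall fun x => ?_
      rw [Set.mem_iUnion]
      by_cases hx : x ∈ ⋃₀ D 0
      · obtain ⟨R, hR, hxR⟩ := hx
        obtain ⟨k, S, hS, hRS, hQS⟩ := hq 0 0 R hR Q hQ
        obtain ⟨T, hT, hST⟩ := hD.exists_ancestor hX (show min k 0 ≤ k from min_le_left _ _) hS
        refine ⟨(min k 0).natAbs, Or.inl ?_⟩
        have e : (-((min k 0).natAbs : ℤ)) = min k 0 := by omega
        obtain ⟨y, hy⟩ := hD.nonempty hX hQ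
        have hP' := hP (min k 0).natAbs
        rw [e] at hP'
        rw [hD.eq_of_mem hP' hT (hQP _ hy) (hST (hQS hy))]
        exact hST (hRS hxR)
      · exact ⟨0, Or.inr hx⟩

lemma countable [SFinite μ] (hX : IsHomogeneousType d μ) (hD : IsDyadicFamily d μ D) (j : ℤ) :
    (D j).Countable := by
  have := Measure.countable_meas_pos_of_disjoint_iUnion (μ := μ) (As := fun Q : D j => (Q : Set X))
    (fun Q => hD.measurableSet j Q Q.2) (fun P Q hPQ => hD.pairwiseDisjoint j P.2 Q.2
      fun h => hPQ (Subtype.ext h))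
  rw [← Set.countable_coe_iff]
  refine (Set.countable_univ_iff).1 (this.mono fun Q _ => hD.measure_pos hX Q.2)

/-- A point of a cube that lies in a cube of the next scale lies in a child. -/
lemma exists_offspring (hD : IsDyadicFamily d μ D) {j : ℤ} {Q : Set X} (hQ : Q ∈ D j) {x : X}
    (hxQ : x ∈ Q) (hx : ∀ j, ∃ Q ∈ D j, x ∈ Q) : ∃ P ∈ offspring D j Q, x ∈ P := by
  obtain ⟨P, hP, hxP⟩ := hx (j + 1)
  exact ⟨P, ⟨hP, hD.subset_of_mem (by omega) hP hQ hxP hxQ⟩, hxP⟩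

/-- The doubling property along the balls of radius `2 ^ n * r`. -/
lemma _root_.IsHomogeneousType.exists_measure_ball_le (hX : IsHomogeneousType d μ) :
    ∃ A : ℝ≥0, ∀ n : ℕ, ∀ x, ∀ r : ℝ, 0 < r →
      μ (quasiBall d x (2 ^ n * r)) ≤ (A : ℝ≥0∞) ^ n * μ (quasiBall d x r) := by
  obtain ⟨A, hA⟩ := hX.doubling
  refine ⟨A, fun n x r hr => ?_⟩
  induction n with
  | zero => simp
  | succ n ih =>
    rw [pow_succ', mul_assoc, pow_succ', mul_assoc]
    exact ((hA x _ (by positivity)).2.2).trans (mul_le_mul_right ih _)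

/-- By doubling the children of a cube have comparable measures, so there are finitely many. -/
lemma offspring_finite (hX : IsHomogeneousType d μ) (hD : IsDyadicFamily d μ D) {j : ℤ}
    {Q : Set X} (hQ : Q ∈ D j) : (offspring D j Q).Finite := by
  obtain ⟨Λ, a₁, a₂, hΛ, hΛ1, h1, h2, h⟩ := hD.size
  obtain ⟨K, hK⟩ := hX.dist_triangle
  obtain ⟨A, hA⟩ := hX.exists_measure_ball_le
  obtain ⟨x, -, -, hx⟩ := h j Q hQ
  obtain ⟨n, hn⟩ := pow_unbounded_of_one_lt
    ((|K| + 1) * (2 * (a₂ * Λ ^ j)) / (a₁ * Λ ^ (j + 1))) (one_lt_two (α := ℝ))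
  rw [div_lt_iff₀ (by positivity)] at hn
  -- a ball about a point of a child that contains the whole cube
  have key : ∀ P ∈ offspring D j Q, μ Q ≤ (A : ℝ≥0∞) ^ n * μ P := by
    rintro P ⟨hP, hPQ⟩
    obtain ⟨y, hyP, hy, -⟩ := h _ P hP
    refine (measure_mono ?_).trans ((hA n y (a₁ * Λ ^ (j + 1)) (by positivity)).trans
      (mul_le_mul_right (measure_mono hy) _))
    intro z hz
    have e1 : d x z < a₂ * Λ ^ j := hx hz
    have e2 : d x y < a₂ * Λ ^ j := hx (hPQ hyP)
    have e3 := hK y x z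
    rw [hX.dist_symm y x] at e3
    change d y z < _
    refine lt_of_le_of_lt (e3.trans ?_) hn
    have n1 := hX.dist_nonneg x y
    have n2 := hX.dist_nonneg x z
    refine mul_le_mul (by linarith [le_abs_self K]) ?_ (by positivity) (by positivity)
    linarith
  have hA0 : (A : ℝ≥0∞) ^ n ≠ ∞ := ENNReal.pow_ne_top ENNReal.coe_ne_top
  have hfin := Measure.finite_const_le_meas_of_disjoint_iUnion μ
    (ε := μ Q / (A : ℝ≥0∞) ^ n) (As := fun P : offspring D j Q => (P : Set X))
    (ENNReal.div_pos (hD.measure_pos hX hQ).ne' hA0)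
    (fun P => hD.measurableSet _ P P.2.1) (fun P R hPR => hD.pairwiseDisjoint _ P.2.1 R.2.1
      fun h => hPR (Subtype.ext h))
    (((measure_mono (Set.iUnion_subset fun P => P.2.2)).trans_lt
      (hD.measure_lt_top hX hQ)).ne)
  rw [← Set.finite_coe_iff, ← Set.finite_univ_iff]
  refine hfin.subset fun P _ => ?_
  exact ENNReal.div_le_of_le_mul' (key P P.2)

end IsDyadicFamily

end Geometry

/-! ### Integrals of powers of a function whose sublevel sets have small measure -/

section Shells

variable {Y : Type*} [MeasurableSpace Y] {ν : Measure Y} {φ : Y → ℝ≥0∞} {α : ℝ}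

/-- The constant `2 ∑ₖ 2 ^ (-αk)`, which bounds sums over dyadic shells. -/
noncomputable def shellConst (α : ℝ) : ℝ≥0∞ := 2 * (1 - 2 ^ (-α))⁻¹

lemma shellConst_ne_top (hα : 0 < α) : shellConst α ≠ ∞ := by
  have : (2 : ℝ≥0∞) ^ (-α) < 1 :=
    ENNReal.rpow_lt_one_of_one_lt_of_neg (by norm_num) (by linarith)
  exact ENNReal.mul_ne_top (by norm_num) (ENNReal.inv_ne_top.2 (tsub_pos_of_lt this).ne')

lemma two_pow_rpow (α : ℝ) (k : ℕ) : ((2 : ℝ≥0∞) ^ k) ^ α = (2 ^ α) ^ k := by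
  rw [← ENNReal.rpow_natCast, ← ENNReal.rpow_natCast, ← ENNReal.rpow_mul, ← ENNReal.rpow_mul,
    mul_comm]

lemma lintegral_shell_le (hν : ∀ s, ν {y | φ y < s} ≤ s) (hφ : Measurable φ) {c : ℝ≥0∞}
    (hc0 : c ≠ 0) (hc : c ≠ ∞) {a : ℝ} (ha : 0 ≤ a) :
    ∫⁻ y in {y | c ≤ φ y ∧ φ y < 2 * c}, φ y ^ (-a) ∂ν ≤ 2 * c ^ (1 - a) := by
  calc ∫⁻ y in {y | c ≤ φ y ∧ φ y < 2 * c}, φ y ^ (-a) ∂ν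
      ≤ ∫⁻ y in {y | c ≤ φ y ∧ φ y < 2 * c}, c ^ (-a) ∂ν := by
        refine setLIntegral_mono' ?_ fun y hy => ?_
        · exact (measurableSet_le measurable_const hφ).inter
            (measurableSet_lt hφ measurable_const)
        · rw [ENNReal.rpow_neg, ENNReal.rpow_neg]
          exact ENNReal.inv_le_inv.2 (ENNReal.rpow_le_rpow hy.1 ha)
    _ ≤ c ^ (-a) * (2 * c) := by
        rw [setLIntegral_const]
        exact mul_le_mul_right ((measure_mono fun y hy => hy.2).trans (hν _)) _
    _ = 2 * c ^ (1 - a) := by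
        rw [show 1 - a = -a + 1 by ring, ENNReal.rpow_add _ _ hc0 hc, ENNReal.rpow_one]
        ring

/-- If `ν {φ < s} ≤ s` for all `s`, then `φ ^ (-1-α)` is integrable away from the zeros of `φ`. -/
lemma lintegral_tail_le (hν : ∀ s, ν {y | φ y < s} ≤ s) (hφ : Measurable φ) (hα : 0 < α)
    {r : ℝ≥0∞} (hr0 : r ≠ 0) (hr : r ≠ ∞) :
    ∫⁻ y in {y | r ≤ φ y}, φ y ^ (-(1 + α)) ∂ν ≤ shellConst α * r ^ (-α) := by
  have hsub : {y | r ≤ φ y} ⊆ {y | φ y = ∞} ∪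
      ⋃ k : ℕ, {y | 2 ^ k * r ≤ φ y ∧ φ y < 2 * (2 ^ k * r)} := by
    intro y hy
    by_cases hty : φ y = ∞
    · exact Or.inl hty
    refine Or.inr (Set.mem_iUnion.2 ?_)
    have h1 : 1 ≤ (φ y / r).toReal := by
      rw [← ENNReal.toReal_one]
      refine ENNReal.toReal_mono (ENNReal.div_ne_top hty hr0) ?_
      rwa [ENNReal.le_div_iff_mul_le (Or.inl hr0) (Or.inl hr), one_mul]
    obtain ⟨k, hk1, hk2⟩ := exists_nat_pow_near h1 (one_lt_two (α := ℝ))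
    have hne := ENNReal.div_ne_top hty hr0
    refine ⟨k, ?_, ?_⟩
    · rw [← ENNReal.le_div_iff_mul_le (Or.inl hr0) (Or.inl hr),
        ← ENNReal.toReal_le_toReal (by simp) hne]
      simpa using hk1
    · rw [← mul_assoc, ← pow_succ', ← ENNReal.div_lt_iff (Or.inl hr0) (Or.inl hr),
        ← ENNReal.toReal_lt_toReal hne (by simp)]
      simpa using hk2
  calc ∫⁻ y in {y | r ≤ φ y}, φ y ^ (-(1 + α)) ∂ν
      ≤ ∫⁻ y in {y | φ y = ∞}, φ y ^ (-(1 + α)) ∂ν +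
        ∫⁻ y in ⋃ k : ℕ, {y | 2 ^ k * r ≤ φ y ∧ φ y < 2 * (2 ^ k * r)}, φ y ^ (-(1 + α)) ∂ν :=
        (lintegral_mono_set hsub).trans (lintegral_union_le _ _ _)
    _ ≤ 0 + ∑' k : ℕ, 2 * (2 ^ k * r) ^ (1 - (1 + α)) := by
        refine add_le_add ?_ ((lintegral_iUnion_le _ _).trans (ENNReal.tsum_le_tsum fun k =>
          lintegral_shell_le hν hφ (mul_ne_zero (by simp) hr0)
            (ENNReal.mul_ne_top (by simp) hr) (by linarith)))
        rw [setLIntegral_congr_fun (g := 0) (show MeasurableSet {y | φ y = ∞} from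
          hφ (measurableSet_singleton _))]
        · simp
        · intro y hy
          have hy : φ y = ∞ := hy
          simp only [hy, Pi.zero_apply]
          exact ENNReal.top_rpow_of_neg (by linarith)
    _ = shellConst α * r ^ (-α) := by
        rw [zero_add, shellConst, ← ENNReal.tsum_geometric, ← ENNReal.tsum_mul_left,
          ← ENNReal.tsum_mul_right]
        refine tsum_congr fun k => ?_
        rw [show 1 - (1 + α) = -α by ring, ENNReal.mul_rpow_of_ne_top (by simp) hr, two_pow_rpow,
          mul_assoc]

/-- If `ν {φ < s} ≤ s` for all `s`, then `φ ^ (-1+α)` is integrable where `φ < 1`. -/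
lemma lintegral_local_le (hν : ∀ s, ν {y | φ y < s} ≤ s) (hφ : Measurable φ) (hα : 0 < α)
    (hα1 : α ≤ 1) :
    ∫⁻ y in {y | φ y < 1}, φ y ^ (-(1 - α)) ∂ν ≤ shellConst α := by
  have hsub : {y | φ y < 1} ⊆ {y | φ y = 0} ∪
      ⋃ k : ℕ, {y | (2 ^ (k + 1))⁻¹ ≤ φ y ∧ φ y < 2 * (2 ^ (k + 1))⁻¹} := by
    intro y hy
    by_cases hty : φ y = 0
    · exact Or.inl hty
    refine Or.inr (Set.mem_iUnion.2 ?_)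
    have hy : φ y < 1 := hy
    have hy' : φ y ≠ ∞ := (hy.trans ENNReal.one_lt_top).ne
    have h0 : 0 < (φ y).toReal := ENNReal.toReal_pos hty hy'
    have h1 : (φ y).toReal ≤ 1 := by
      rw [← ENNReal.toReal_one]
      exact ENNReal.toReal_mono (by simp) hy.le
    obtain ⟨k, hk1, hk2⟩ := exists_nat_pow_near_of_lt_one h0 h1 (y := (1 / 2 : ℝ))
      (by norm_num) (by norm_num)
    rcases hk2.lt_or_eq with hk2 | hk2
    · refine ⟨k, ?_, ?_⟩
      · rw [← ENNReal.toReal_le_toReal (by simp) hy']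
        simpa using hk1.le
      · rw [← ENNReal.toReal_lt_toReal hy' (ENNReal.mul_ne_top (by simp) (by simp))]
        simpa [pow_succ] using hk2
    · have hk0 : k ≠ 0 := by
        rintro rfl
        rw [pow_zero] at hk2
        rw [← ENNReal.ofReal_toReal hy', hk2] at hy
        simp at hy
      obtain ⟨m, rfl⟩ := Nat.exists_eq_succ_of_ne_zero hk0
      refine ⟨m, ?_, ?_⟩
      · rw [← ENNReal.toReal_le_toReal (by simp) hy']
        simpa using hk2.ge
      · rw [← ENNReal.toReal_lt_toReal hy' (ENNReal.mul_ne_top (by simp) (by simp)), hk2]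
        simp only [pow_succ, ENNReal.toReal_mul, ENNReal.toReal_inv, ENNReal.toReal_pow,
          ENNReal.toReal_ofNat, one_div, inv_pow, mul_inv]
        have : (0 : ℝ) < (2 ^ m)⁻¹ := by positivity
        linarith
  have h0 : ν {y | φ y = 0} = 0 := by
    refine le_antisymm (le_of_forall_pos_le_add fun ε hε => ?_) zero_le
    rw [zero_add]
    refine (measure_mono fun y hy => ?_).trans (hν ε)
    have hy : φ y = 0 := hy
    simpa [hy] using hε
  calc ∫⁻ y in {y | φ y < 1}, φ y ^ (-(1 - α)) ∂ν
      ≤ ∫⁻ y in {y | φ y = 0}, φ y ^ (-(1 - α)) ∂ν +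
        ∫⁻ y in ⋃ k : ℕ, {y | (2 ^ (k + 1))⁻¹ ≤ φ y ∧ φ y < 2 * (2 ^ (k + 1))⁻¹},
          φ y ^ (-(1 - α)) ∂ν :=
        (lintegral_mono_set hsub).trans (lintegral_union_le _ _ _)
    _ ≤ 0 + ∑' k : ℕ, 2 * ((2 ^ (k + 1))⁻¹) ^ (1 - (1 - α)) := by
        refine add_le_add ?_ ((lintegral_iUnion_le _ _).trans (ENNReal.tsum_le_tsum fun k =>
          lintegral_shell_le hν hφ (by simp) (by simp) (by linarith)))
        rw [Measure.restrict_eq_zero.2 h0, lintegral_zero_measure]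
    _ ≤ shellConst α := by
        rw [zero_add, shellConst, ← ENNReal.tsum_geometric, ← ENNReal.tsum_mul_left]
        refine ENNReal.tsum_le_tsum fun k => mul_le_mul_right ?_ _
        rw [show 1 - (1 - α) = α by ring, ← two_pow_rpow, ENNReal.inv_rpow, ← ENNReal.rpow_neg]
        rw [ENNReal.rpow_neg, ENNReal.rpow_neg]
        exact ENNReal.inv_le_inv.2 (ENNReal.rpow_le_rpow
          (pow_le_pow_right₀ (by norm_num) (Nat.le_succ k)) hα.le)

end Shells

/-! ### The dyadic distance -/

section Distance

variable {X : Type*} [MeasurableSpace X] {d : X → X → ℝ} {μ : Measure X} {D : ℤ → Set (Set X)}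

/-- The infimum of the measures of the cubes that contain `x` and `y`, in `[0, ∞]`. Off the diagonal
its real value is `dyadicDist`. The absence of the case distinction makes it measurable, and it is
`∞` for points without a common cube. -/
noncomputable def cubeDist (D : ℤ → Set (Set X)) (μ : Measure X) (x y : X) : ℝ≥0∞ :=
  ⨅ (j) (Q ∈ D j) (_ : x ∈ Q ∧ y ∈ Q), μ Q

lemma cubeDist_comm (x y : X) : cubeDist D μ x y = cubeDist D μ y x := by
  simp only [cubeDist, and_comm]

lemma cubeDist_lt_iff {x y : X} {s : ℝ≥0∞} :
    cubeDist D μ x y < s ↔ ∃ j, ∃ Q ∈ D j, (x ∈ Q ∧ y ∈ Q) ∧ μ Q < s := by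
  simp only [cubeDist, iInf_lt_iff, exists_prop]

lemma le_cubeDist_iff {x y : X} {s : ℝ≥0∞} :
    s ≤ cubeDist D μ x y ↔ ∀ j, ∀ Q ∈ D j, x ∈ Q ∧ y ∈ Q → s ≤ μ Q := by
  simp only [cubeDist, le_iInf_iff]

lemma cubeDist_le {x y : X} {j : ℤ} {Q : Set X} (hQ : Q ∈ D j) (hx : x ∈ Q) (hy : y ∈ Q) :
    cubeDist D μ x y ≤ μ Q :=
  le_cubeDist_iff.1 le_rfl j Q hQ ⟨hx, hy⟩

namespace IsDyadicFamily

lemma measurable_cubeDist [SFinite μ] (hX : IsHomogeneousType d μ) (hD : IsDyadicFamily d μ D) :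
    Measurable fun p : X × X => cubeDist D μ p.1 p.2 := by
  classical
  unfold cubeDist
  refine Measurable.iInf fun j => Measurable.biInf (D j) (hD.countable hX j) fun Q hQ => ?_
  simp only [iInf_eq_if]
  have hm := hD.measurableSet j Q hQ
  exact Measurable.ite ((measurable_fst hm).inter (measurable_snd hm)) measurable_const
    measurable_const

lemma measurable_cubeDist_right [SFinite μ] (hX : IsHomogeneousType d μ)
    (hD : IsDyadicFamily d μ D) (x : X) : Measurable fun y => cubeDist D μ x y :=
  Measurable.comp (g := fun p : X × X => cubeDist D μ p.1 p.2) (f := fun y => (x, y))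
    (hD.measurable_cubeDist hX) measurable_prodMk_left

/-- The balls of the dyadic distance are increasing unions of cubes. -/
lemma measure_cubeDist_lt (hD : IsDyadicFamily d μ D) (x : X) (s : ℝ≥0∞) :
    μ {y | cubeDist D μ x y < s} ≤ s := by
  let J : Set ℤ := {j | ∃ Q ∈ D j, x ∈ Q ∧ μ Q < s}
  have hJ : ∀ j : J, ∃ Q ∈ D j, x ∈ Q ∧ μ Q < s := fun j => j.2
  choose Q hQ hx hs using hJ
  have hsub : {y | cubeDist D μ x y < s} ⊆ ⋃ j, Q j := by
    intro y hy
    obtain ⟨j, R, hR, hxy, hRs⟩ := cubeDist_lt_iff.1 hy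
    refine Set.mem_iUnion.2 ⟨⟨j, R, hR, hxy.1, hRs⟩, ?_⟩
    rw [hD.eq_of_mem (hQ _) hR (hx _) hxy.1]
    exact hxy.2
  refine (measure_mono hsub).trans ?_
  rw [Directed.measure_iUnion]
  · exact iSup_le fun j => (hs j).le
  · intro i j
    rcases le_total (i : ℤ) j with h | h
    · exact ⟨i, le_rfl, hD.subset_of_mem h (hQ j) (hQ i) (hx j) (hx i)⟩
    · exact ⟨j, hD.subset_of_mem h (hQ i) (hQ j) (hx i) (hx j), le_rfl⟩

lemma cubeDist_congr (hD : IsDyadicFamily d μ D) {j : ℤ} {Q : Set X} (hQ : Q ∈ D j) {x x' y : X}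
    (hx : x ∈ Q) (hx' : x' ∈ Q) (hy : y ∉ Q) : cubeDist D μ x y = cubeDist D μ x' y := by
  have key : ∀ {a b : X}, a ∈ Q → b ∈ Q → cubeDist D μ a y ≤ cubeDist D μ b y := by
    intro a b ha hb
    refine le_cubeDist_iff.2 fun i R hR hbR => ?_
    have hij : i ≤ j := by
      by_contra! h
      exact hy (hD.subset_of_mem h.le hR hQ hbR.1 hb hbR.2)
    exact cubeDist_le hR (hD.subset_of_mem hij hQ hR hb hbR.1 ha) hbR.2
  exact le_antisymm (key hx hx') (key hx' hx)

lemma measure_le_cubeDist (hD : IsDyadicFamily d μ D) {j : ℤ} {Q : Set X} (hQ : Q ∈ D j)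
    {x y : X} (hx : x ∈ Q) (hy : y ∉ Q) : μ Q ≤ cubeDist D μ x y := by
  refine le_cubeDist_iff.2 fun i R hR hxR => measure_mono ?_
  have hij : i ≤ j := by
    by_contra! h
    exact hy (hD.subset_of_mem h.le hR hQ hxR.1 hx hxR.2)
  exact hD.subset_of_mem hij hQ hR hx hxR.1

lemma cubeDist_eq_measure (hX : IsHomogeneousType d μ) (hD : IsDyadicFamily d μ D) {j : ℤ}
    {Q : Set X} (hQ : Q ∈ D j) {x y : X} (hx : x ∈ Q) (hy : y ∈ Q)
    (hxy : ∀ P ∈ offspring D j Q, x ∈ P → y ∉ P) : cubeDist D μ x y = μ Q := by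
  refine le_antisymm (cubeDist_le hQ hx hy) (le_cubeDist_iff.2 fun i R hR hxR => ?_)
  have hij : i ≤ j := by
    by_contra! h
    obtain ⟨P, hP, hRP⟩ := hD.exists_ancestor hX (show j + 1 ≤ i by omega) hR
    exact hxy P ⟨hP, hD.subset_of_mem (by omega) hP hQ (hRP hxR.1) hx⟩ (hRP hxR.1) (hRP hxR.2)
  exact measure_mono (hD.subset_of_mem hij hQ hR hx hxR.1)

lemma dyadicDist_eq (hX : IsHomogeneousType d μ) (hD : IsDyadicFamily d μ D) {x y : X}
    (hxy : x ≠ y) : dyadicDist D μ x y = (cubeDist D μ x y).toReal := by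
  let S := {Q // ∃ j, Q ∈ D j ∧ x ∈ Q ∧ y ∈ Q}
  have h1 : cubeDist D μ x y = ⨅ Q : S, μ Q.1 := by
    refine le_antisymm (le_iInf fun ⟨Q, j, hQ, hx, hy⟩ => cubeDist_le hQ hx hy)
      (le_cubeDist_iff.2 fun j Q hQ h => iInf_le (fun Q : S => μ Q.1) ⟨Q, j, hQ, h.1, h.2⟩)
  rw [dyadicDist, if_neg hxy, h1, ENNReal.toReal_iInf
    (fun Q => by obtain ⟨Q, j, hQ, -⟩ := Q; exact (hD.measure_lt_top hX hQ).ne), iInf]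
  congr 1
  ext r
  constructor
  · rintro ⟨j, Q, hQ, hx, hy, rfl⟩
    exact ⟨⟨Q, j, hQ, hx, hy⟩, rfl⟩
  · rintro ⟨⟨Q, j, hQ, hx, hy⟩, rfl⟩
    exact ⟨j, Q, hQ, hx, hy, rfl⟩

end IsDyadicFamily

end Distance

/-! ### The kernel of the fractional derivative -/

section Kernel

variable {X : Type*} [MeasurableSpace X] {d : X → X → ℝ} {μ : Measure X} {D : ℤ → Set (Set X)}

/-- The kernel `δ(x,y)^(-a)`, with the value `0` where `cubeDist` is `0` or `∞`. -/
noncomputable def dyadicKernel (D : ℤ → Set (Set X)) (μ : Measure X) (a : ℝ) (x y : X) : ℝ :=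
  (cubeDist D μ x y ^ (-a)).toReal

lemma dyadicKernel_nonneg (a : ℝ) (x y : X) : 0 ≤ dyadicKernel D μ a x y := ENNReal.toReal_nonneg

lemma dyadicKernel_comm (a : ℝ) (x y : X) : dyadicKernel D μ a x y = dyadicKernel D μ a y x := by
  rw [dyadicKernel, cubeDist_comm, dyadicKernel]

lemma dyadicKernel_half_mul_half (a : ℝ) (x y : X) :
    dyadicKernel D μ (a / 2) x y * dyadicKernel D μ (a / 2) x y = dyadicKernel D μ a x y := by
  rw [dyadicKernel, dyadicKernel, ← ENNReal.toReal_mul, ← sq, ← ENNReal.rpow_natCast,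
    ← ENNReal.rpow_mul]
  congr 2
  push_cast
  ring

lemma enorm_dyadicKernel_le (a : ℝ) (x y : X) :
    ‖dyadicKernel D μ a x y‖ₑ ≤ cubeDist D μ x y ^ (-a) := by
  rw [Real.enorm_eq_ofReal (dyadicKernel_nonneg a x y)]
  exact ENNReal.ofReal_toReal_le

namespace IsDyadicFamily

/-- On the diagonal, where `dyadicDist` is `0`, both sides vanish because the numerator does. -/
lemma div_dyadicDist_rpow (hX : IsHomogeneousType d μ) (hD : IsDyadicFamily d μ D) (a : ℝ)
    (f : X → ℂ) (x y : X) :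
    (f x - f y) / ((dyadicDist D μ x y ^ a : ℝ) : ℂ) = (f x - f y) * dyadicKernel D μ a x y := by
  rcases eq_or_ne x y with rfl | hxy
  · simp
  · rw [hD.dyadicDist_eq hX hxy, dyadicKernel, ENNReal.toReal_rpow, ENNReal.rpow_neg,
      ENNReal.toReal_inv, div_eq_mul_inv]
    push_cast
    rfl

lemma besovQuotient_eq (hX : IsHomogeneousType d μ) (hD : IsDyadicFamily d μ D) (σ : ℝ)
    (f : X → ℂ) (p : X × X) :
    besovQuotient D μ σ f p = (f p.1 - f p.2) * dyadicKernel D μ ((1 + 2 * σ) / 2) p.1 p.2 :=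
  hD.div_dyadicDist_rpow hX _ f _ _

lemma shellConst_mul_ne_top (hX : IsHomogeneousType d μ) (hD : IsDyadicFamily d μ D)
    {α : ℝ} (hα : 0 < α) {j : ℤ} {Q : Set X} (hQ : Q ∈ D j) : shellConst α * μ Q ^ (-α) ≠ ∞ :=
  ENNReal.mul_ne_top (shellConst_ne_top hα)
    (ENNReal.rpow_ne_top_of_ne_zero (hD.measure_pos hX hQ).ne' (hD.measure_lt_top hX hQ).ne)

variable [SFinite μ]

lemma measurable_dyadicKernel (hX : IsHomogeneousType d μ) (hD : IsDyadicFamily d μ D) (a : ℝ) :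
    Measurable fun p : X × X => dyadicKernel D μ a p.1 p.2 :=
  ((hD.measurable_cubeDist hX).pow_const _).ennreal_toReal

lemma measurable_dyadicKernel_right (hX : IsHomogeneousType d μ) (hD : IsDyadicFamily d μ D)
    (a : ℝ) (x : X) : Measurable fun y => dyadicKernel D μ a x y :=
  ((hD.measurable_cubeDist_right hX x).pow_const _).ennreal_toReal

lemma lintegral_compl_cubeDist_le (hX : IsHomogeneousType d μ) (hD : IsDyadicFamily d μ D)
    {α : ℝ} (hα : 0 < α) {j : ℤ} {Q : Set X} (hQ : Q ∈ D j) {x : X} (hx : x ∈ Q) :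
    ∫⁻ y in Qᶜ, cubeDist D μ x y ^ (-(1 + α)) ∂μ ≤ shellConst α * μ Q ^ (-α) :=
  (lintegral_mono_set fun _ hy => hD.measure_le_cubeDist hQ hx hy).trans
    (lintegral_tail_le (hD.measure_cubeDist_lt x) (hD.measurable_cubeDist_right hX x) hα
      (hD.measure_pos hX hQ).ne' (hD.measure_lt_top hX hQ).ne)

lemma lintegral_compl_dyadicKernel_le (hX : IsHomogeneousType d μ) (hD : IsDyadicFamily d μ D)
    {α : ℝ} (hα : 0 < α) {j : ℤ} {Q : Set X} (hQ : Q ∈ D j) {x : X} (hx : x ∈ Q) :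
    ∫⁻ y in Qᶜ, ‖dyadicKernel D μ (1 + α) x y‖ₑ ∂μ ≤ shellConst α * μ Q ^ (-α) :=
  (lintegral_mono fun y => enorm_dyadicKernel_le _ x y).trans
    (hD.lintegral_compl_cubeDist_le hX hα hQ hx)

lemma integrableOn_compl_dyadicKernel (hX : IsHomogeneousType d μ) (hD : IsDyadicFamily d μ D)
    {α : ℝ} (hα : 0 < α) {j : ℤ} {Q : Set X} (hQ : Q ∈ D j) {x : X} (hx : x ∈ Q) :
    IntegrableOn (fun y => dyadicKernel D μ (1 + α) x y) Qᶜ μ :=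
  ⟨(hD.measurable_dyadicKernel_right hX _ x).aestronglyMeasurable,
    (hD.lintegral_compl_dyadicKernel_le hX hα hQ hx).trans_lt
      (hD.shellConst_mul_ne_top hX hα hQ).lt_top⟩

lemma memLp_compl_dyadicKernel (hX : IsHomogeneousType d μ) (hD : IsDyadicFamily d μ D)
    {α : ℝ} (hα : 0 < α) {j : ℤ} {Q : Set X} (hQ : Q ∈ D j) {x : X} (hx : x ∈ Q) :
    MemLp (fun y => dyadicKernel D μ (1 + α) x y) 2 (μ.restrict Qᶜ) := by
  rw [memLp_two_iff_integrable_sq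
    (hD.measurable_dyadicKernel_right hX _ x).aestronglyMeasurable]
  refine (hD.integrableOn_compl_dyadicKernel hX (show 0 < 1 + 2 * α by linarith) hQ
    hx).congr (.of_forall fun y => ?_)
  simp only
  rw [sq, show 1 + α = (1 + (1 + 2 * α)) / 2 by ring, dyadicKernel_half_mul_half]

end IsDyadicFamily

/-- The eigenvalue `μ(Q)^(-α) + ∫_{X \ Q} δ(x,y)^(-1-α) dμ(y)`, `x ∈ Q`, of the fractional
derivative of order `α` on the wavelets based on `Q`. The integral does not depend on `x ∈ Q`; its
average over `Q` saves the choice of a point. -/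
noncomputable def dyadicEigenvalue (D : ℤ → Set (Set X)) (μ : Measure X) (α : ℝ) (Q : Set X) : ℝ :=
  μ.real Q ^ (-α) + ⨍ x in Q, ∫ y in Qᶜ, dyadicKernel D μ (1 + α) x y ∂μ ∂μ

namespace IsDyadicFamily

lemma dyadicKernel_congr (hD : IsDyadicFamily d μ D) {j : ℤ} {Q : Set X} (hQ : Q ∈ D j)
    (a : ℝ) {x x' y : X} (hx : x ∈ Q) (hx' : x' ∈ Q) (hy : y ∉ Q) :
    dyadicKernel D μ a x y = dyadicKernel D μ a x' y := by
  rw [dyadicKernel, hD.cubeDist_congr hQ hx hx' hy, dyadicKernel]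

lemma dyadicEigenvalue_eq (hX : IsHomogeneousType d μ) (hD : IsDyadicFamily d μ D) (α : ℝ)
    {j : ℤ} {Q : Set X} (hQ : Q ∈ D j) {x : X} (hx : x ∈ Q) :
    dyadicEigenvalue D μ α Q =
      μ.real Q ^ (-α) + ∫ y in Qᶜ, dyadicKernel D μ (1 + α) x y ∂μ := by
  rw [dyadicEigenvalue, setAverage_eq, setIntegral_congr_fun (hD.measurableSet j Q hQ)
    (g := fun _ => ∫ y in Qᶜ, dyadicKernel D μ (1 + α) x y ∂μ), setIntegral_const, smul_smul,
    inv_mul_cancel₀ (hD.real_pos hX hQ).ne', one_smul]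
  intro x' hx'
  exact setIntegral_congr_fun (hD.measurableSet j Q hQ).compl fun y hy =>
    hD.dyadicKernel_congr hQ _ hx' hx hy

lemma rpow_le_dyadicEigenvalue (hX : IsHomogeneousType d μ) (hD : IsDyadicFamily d μ D) (α : ℝ)
    {j : ℤ} {Q : Set X} (hQ : Q ∈ D j) : μ.real Q ^ (-α) ≤ dyadicEigenvalue D μ α Q := by
  obtain ⟨x, hx⟩ := hD.nonempty hX hQ
  rw [hD.dyadicEigenvalue_eq hX α hQ hx]
  exact le_add_of_nonneg_right (integral_nonneg fun y => dyadicKernel_nonneg _ x y)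

lemma dyadicEigenvalue_pos (hX : IsHomogeneousType d μ) (hD : IsDyadicFamily d μ D) (α : ℝ)
    {j : ℤ} {Q : Set X} (hQ : Q ∈ D j) : 0 < dyadicEigenvalue D μ α Q :=
  (Real.rpow_pos_of_pos (hD.real_pos hX hQ) _).trans_le (hD.rpow_le_dyadicEigenvalue hX α hQ)

lemma dyadicEigenvalue_le [SFinite μ] (hX : IsHomogeneousType d μ) (hD : IsDyadicFamily d μ D)
    {α : ℝ} (hα : 0 < α) {j : ℤ} {Q : Set X} (hQ : Q ∈ D j) :
    dyadicEigenvalue D μ α Q ≤ (1 + (shellConst α).toReal) * μ.real Q ^ (-α) := by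
  obtain ⟨x, hx⟩ := hD.nonempty hX hQ
  rw [hD.dyadicEigenvalue_eq hX α hQ hx, add_mul, one_mul]
  refine add_le_add le_rfl ?_
  have h := ENNReal.toReal_mono (hD.shellConst_mul_ne_top hX hα hQ)
    (hD.lintegral_compl_dyadicKernel_le hX hα hQ hx)
  rw [ENNReal.toReal_mul, ← ENNReal.toReal_rpow] at h
  refine le_trans (le_of_eq ?_) h
  rw [← integral_norm_eq_lintegral_enorm
    (hD.measurable_dyadicKernel_right hX _ x).aestronglyMeasurable]
  refine integral_congr_ae (.of_forall fun y => ?_)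
  exact (Real.norm_of_nonneg (dyadicKernel_nonneg _ x y)).symm

end IsDyadicFamily

end Kernel

/-! ### Wavelets are eigenfunctions -/

section Wavelet

variable {X : Type*} [MeasurableSpace X] {d : X → X → ℝ} {μ : Measure X} {D : ℤ → Set (Set X)}

/-- A complex wavelet based on `Q`: a mean-zero function in `L²` that vanishes off the cube `Q` of
scale `j` and is constant on each child of `Q`. -/
structure IsWavelet (D : ℤ → Set (Set X)) (μ : Measure X) (j : ℤ) (Q : Set X) (φ : X → ℂ) :
    Prop where
  mem : Q ∈ D j
  eq_zero : ∀ x ∉ Q, φ x = 0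
  const : ∀ P ∈ offspring D j Q, ∃ c : ℂ, ∀ x ∈ P, φ x = c
  integral : ∫ x, φ x ∂μ = 0
  memLp : MemLp φ 2 μ

namespace IsWavelet

variable {j : ℤ} {Q : Set X} {φ : X → ℂ}

lemma integrable (hX : IsHomogeneousType d μ) (hD : IsDyadicFamily d μ D)
    (hφ : IsWavelet D μ j Q φ) : Integrable φ μ := by
  have : IsFiniteMeasure (μ.restrict Q) := ⟨by simpa using hD.measure_lt_top hX hφ.mem⟩
  have h : IntegrableOn φ Q μ := (hφ.memLp.restrict Q).integrable (by norm_num)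
  rw [integrableOn_iff_integrable_of_support_subset] at h
  · exact h
  · intro x hx
    by_contra hxQ
    exact hx (hφ.eq_zero x hxQ)

/-- For `x ∈ Q` the distance `δ(x,y)` is `μ(Q)` for the `y ∈ Q` with `φ y ≠ φ x`. -/
lemma sub_mul_kernel_of_mem (hX : IsHomogeneousType d μ) (hD : IsDyadicFamily d μ D)
    (hφ : IsWavelet D μ j Q φ) (a : ℝ) {x : X} (hx : x ∈ Q) (y : X) :
    (φ x - φ y) * dyadicKernel D μ a x y =
      Q.indicator (fun y => (φ x - φ y) * (μ.real Q ^ (-a) : ℝ)) y +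
        Qᶜ.indicator (fun y => φ x * dyadicKernel D μ a x y) y := by
  by_cases hy : y ∈ Q
  · rw [Set.indicator_of_mem hy, Set.indicator_of_notMem (by simpa using hy), add_zero]
    by_cases he : φ x = φ y
    · simp [he]
    · rw [dyadicKernel, hD.cubeDist_eq_measure hX hφ.mem hx hy, ← ENNReal.toReal_rpow]
      · rfl
      · intro P hP hxP hyP
        obtain ⟨c, hc⟩ := hφ.const P hP
        exact he (by rw [hc x hxP, hc y hyP])
  · rw [Set.indicator_of_notMem hy, Set.indicator_of_mem (by simpa using hy), zero_add,
      hφ.eq_zero y hy, sub_zero]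

lemma sub_mul_kernel_of_notMem (hD : IsDyadicFamily d μ D) (hφ : IsWavelet D μ j Q φ) (a : ℝ)
    {x x₀ : X} (hx : x ∉ Q) (hx₀ : x₀ ∈ Q) (y : X) :
    (φ x - φ y) * dyadicKernel D μ a x y = -φ y * dyadicKernel D μ a x₀ x := by
  rw [hφ.eq_zero x hx, zero_sub]
  by_cases hy : y ∈ Q
  · rw [dyadicKernel_comm a x y, hD.dyadicKernel_congr hφ.mem a hy hx₀ hx]
  · rw [hφ.eq_zero y hy]
    simp

lemma integrable_inner_part (hX : IsHomogeneousType d μ) (hD : IsDyadicFamily d μ D)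
    (hφ : IsWavelet D μ j Q φ) (x : X) (c : ℂ) :
    Integrable (Q.indicator (fun y => (φ x - φ y) * c)) μ := by
  rw [integrable_indicator_iff (hD.measurableSet j Q hφ.mem)]
  refine Integrable.mul_const (Integrable.sub ?_ (hφ.integrable hX hD).integrableOn) c
  exact integrableOn_const (hD.measure_lt_top hX hφ.mem).ne

variable [SFinite μ] {α : ℝ}

lemma integrable_outer_part (hX : IsHomogeneousType d μ) (hD : IsDyadicFamily d μ D)
    (hφ : IsWavelet D μ j Q φ) (hα : 0 < α) {x : X} (hx : x ∈ Q) :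
    Integrable (Qᶜ.indicator (fun y => φ x * dyadicKernel D μ (1 + α) x y)) μ := by
  rw [integrable_indicator_iff (hD.measurableSet j Q hφ.mem).compl]
  exact ((hD.integrableOn_compl_dyadicKernel hX hα hφ.mem hx).ofReal).const_mul _

lemma integrable_sub_mul_kernel (hX : IsHomogeneousType d μ) (hD : IsDyadicFamily d μ D)
    (hφ : IsWavelet D μ j Q φ) (hα : 0 < α) (x : X) :
    Integrable (fun y => (φ x - φ y) * dyadicKernel D μ (1 + α) x y) μ := by
  by_cases hx : x ∈ Q
  · simp_rw [hφ.sub_mul_kernel_of_mem hX hD _ hx]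
    exact (hφ.integrable_inner_part hX hD x _).add (hφ.integrable_outer_part hX hD hα hx)
  · obtain ⟨x₀, hx₀⟩ := hD.nonempty hX hφ.mem
    simp_rw [hφ.sub_mul_kernel_of_notMem hD _ hx hx₀]
    exact (hφ.integrable hX hD).neg.mul_const _

/-- Wavelets are eigenfunctions of the fractional derivative. -/
lemma integral_sub_mul_kernel (hX : IsHomogeneousType d μ) (hD : IsDyadicFamily d μ D)
    (hφ : IsWavelet D μ j Q φ) (hα : 0 < α) (x : X) :
    ∫ y, (φ x - φ y) * dyadicKernel D μ (1 + α) x y ∂μ = dyadicEigenvalue D μ α Q * φ x := by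
  have hQm := hD.measurableSet j Q hφ.mem
  have hQ0 := hD.real_pos hX hφ.mem
  by_cases hx : x ∈ Q
  · have hc : IntegrableOn (fun _ => φ x) Q μ :=
      integrableOn_const (hD.measure_lt_top hX hφ.mem).ne
    simp_rw [hφ.sub_mul_kernel_of_mem hX hD _ hx]
    rw [integral_add (hφ.integrable_inner_part hX hD x _)
      (hφ.integrable_outer_part hX hD hα hx), integral_indicator hQm, integral_indicator hQm.compl,
      integral_mul_const, integral_const_mul, integral_complex_ofReal, integral_sub
      hc.integrable (hφ.integrable hX hD).integrableOn,
      setIntegral_const, setIntegral_eq_integral_of_forall_compl_eq_zero hφ.eq_zero,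
      hφ.integral, hD.dyadicEigenvalue_eq hX α hφ.mem hx]
    have e : μ.real Q * μ.real Q ^ (-(1 + α)) = μ.real Q ^ (-α) := by
      rw [show -α = 1 + -(1 + α) by ring, Real.rpow_add hQ0, Real.rpow_one]
    rw [← e, sub_zero, Complex.real_smul]
    push_cast
    ring
  · obtain ⟨x₀, hx₀⟩ := hD.nonempty hX hφ.mem
    simp_rw [hφ.sub_mul_kernel_of_notMem hD _ hx hx₀]
    rw [integral_mul_const, integral_neg, hφ.integral, hφ.eq_zero x hx]
    simp

lemma exists_integral_norm_le (hX : IsHomogeneousType d μ) (hD : IsDyadicFamily d μ D)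
    (hφ : IsWavelet D μ j Q φ) (hα : 0 < α) :
    ∃ g : X → ℝ, MemLp g 2 μ ∧
      ∀ x, ∫ y, ‖(φ x - φ y) * dyadicKernel D μ (1 + α) x y‖ ∂μ ≤ g x := by
  have hQm := hD.measurableSet j Q hφ.mem
  have hQ0 := hD.real_pos hX hφ.mem
  have hQt := (hD.measure_lt_top hX hφ.mem).ne
  obtain ⟨x₀, hx₀⟩ := hD.nonempty hX hφ.mem
  have hint := hφ.integrable hX hD
  set N : ℝ := ∫ y, ‖φ y‖ ∂μ with hN
  have hN0 : 0 ≤ N := integral_nonneg fun y => norm_nonneg _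
  refine ⟨fun x => dyadicEigenvalue D μ α Q * ‖φ x‖ +
    (Q.indicator (fun _ => N * μ.real Q ^ (-(1 + α))) x +
      Qᶜ.indicator (fun x => N * dyadicKernel D μ (1 + α) x₀ x) x), ?_, fun x => ?_⟩
  · have h1 := hφ.memLp.norm.const_mul (dyadicEigenvalue D μ α Q)
    have h2 := memLp_indicator_const 2 hQm (N * μ.real Q ^ (-(1 + α))) (Or.inr hQt)
    have h3 := (hD.memLp_compl_dyadicKernel hX hα hφ.mem hx₀).const_mul N
    rw [← memLp_indicator_iff_restrict hQm.compl] at h3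
    exact h1.add (h2.add h3)
  · beta_reduce
    by_cases hx : x ∈ Q
    · rw [Set.indicator_of_mem hx, Set.indicator_of_notMem (by simpa using hx), add_zero]
      have hB := hφ.integrable_outer_part hX hD hα hx
      have hA := hφ.integrable_inner_part hX hD x ((μ.real Q ^ (-(1 + α)) : ℝ) : ℂ)
      simp_rw [hφ.sub_mul_kernel_of_mem hX hD _ hx]
      calc _ ≤ ∫ y, ‖Q.indicator (fun y => (φ x - φ y) * (μ.real Q ^ (-(1 + α)) : ℝ)) y‖ +
              ‖Qᶜ.indicator (fun y => φ x * dyadicKernel D μ (1 + α) x y) y‖ ∂μ :=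
            integral_mono (hA.add hB).norm (hA.norm.add hB.norm) fun y => norm_add_le _ _
        _ ≤ _ := by
          rw [integral_add hA.norm hB.norm]
          simp_rw [norm_indicator_eq_indicator_norm]
          rw [integral_indicator hQm, integral_indicator hQm.compl]
          simp_rw [norm_mul, Complex.norm_real, Real.norm_eq_abs,
            abs_of_nonneg (dyadicKernel_nonneg _ _ _)]
          rw [integral_mul_const, integral_const_mul, hD.dyadicEigenvalue_eq hX α hφ.mem hx]
          have e : μ.real Q * μ.real Q ^ (-(1 + α)) = μ.real Q ^ (-α) := by
            rw [show -α = 1 + -(1 + α) by ring, Real.rpow_add hQ0, Real.rpow_one]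
          have hr : 0 ≤ μ.real Q ^ (-(1 + α)) := Real.rpow_nonneg hQ0.le _
          rw [abs_of_nonneg hr, ← e]
          have h1 : ∫ y in Q, ‖φ x - φ y‖ ∂μ ≤ μ.real Q * ‖φ x‖ + N := by
            calc ∫ y in Q, ‖φ x - φ y‖ ∂μ ≤ ∫ y in Q, (‖φ x‖ + ‖φ y‖) ∂μ :=
                  integral_mono (((integrableOn_const hQt).sub hint.integrableOn).norm)
                    ((integrableOn_const hQt).add hint.norm.integrableOn)
                    fun y => norm_sub_le _ _
              _ = μ.real Q * ‖φ x‖ + ∫ y in Q, ‖φ y‖ ∂μ := by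
                  have hc : IntegrableOn (fun _ => ‖φ x‖) Q μ := integrableOn_const hQt
                  rw [integral_add hc.integrable hint.norm.integrableOn,
                    setIntegral_const, smul_eq_mul]
              _ ≤ _ := add_le_add le_rfl (setIntegral_le_integral hint.norm
                  (.of_forall fun y => norm_nonneg _))
          nlinarith [mul_le_mul_of_nonneg_right h1 hr]
    · rw [Set.indicator_of_notMem hx, Set.indicator_of_mem (by simpa using hx), zero_add]
      simp_rw [hφ.sub_mul_kernel_of_notMem hD _ hx hx₀]
      simp_rw [norm_mul, Complex.norm_real, Real.norm_eq_abs,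
        abs_of_nonneg (dyadicKernel_nonneg _ _ _), norm_neg]
      rw [integral_mul_const, hφ.eq_zero x hx]
      simp [hN]

/-- The quadratic form of the fractional derivative, paired with a wavelet: splitting
`f(x) - f(y)` and using the antisymmetry of `φ(x) - φ(y)` reduces it to the eigenvalue equation. -/
lemma integral_prod_sub_mul (hX : IsHomogeneousType d μ) (hD : IsDyadicFamily d μ D)
    (hφ : IsWavelet D μ j Q φ) (hα : 0 < α) {f : X → ℂ} (hf : MemLp f 2 μ) :
    Integrable (fun p : X × X => (φ p.1 - φ p.2) * dyadicKernel D μ (1 + α) p.1 p.2 *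
      (f p.1 - f p.2)) (μ.prod μ) ∧
    ∫ p : X × X, (φ p.1 - φ p.2) * dyadicKernel D μ (1 + α) p.1 p.2 * (f p.1 - f p.2) ∂μ.prod μ =
      2 * dyadicEigenvalue D μ α Q * ∫ x, φ x * f x ∂μ := by
  set A : X × X → ℂ := fun p => (φ p.1 - φ p.2) * dyadicKernel D μ (1 + α) p.1 p.2 * f p.1
  have hAm : AEStronglyMeasurable A (μ.prod μ) := by
    have h1 := hφ.memLp.aestronglyMeasurable
    refine ((h1.comp_fst.sub h1.comp_snd).mul ?_).mul hf.aestronglyMeasurable.comp_fst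
    exact (Complex.measurable_ofReal.comp
      (hD.measurable_dyadicKernel hX (1 + α))).aestronglyMeasurable
  have hA : Integrable A (μ.prod μ) := by
    rw [integrable_prod_iff hAm]
    refine ⟨.of_forall fun x => (hφ.integrable_sub_mul_kernel hX hD hα x).mul_const (f x), ?_⟩
    obtain ⟨g, hg, hgle⟩ := hφ.exists_integral_norm_le hX hD hα
    refine (hg.integrable_mul hf.norm).mono' hAm.norm.integral_prod_right' (.of_forall fun x => ?_)
    simp only [A, norm_mul _ (f x), integral_mul_const, Pi.mul_apply]
    rw [Real.norm_of_nonneg (mul_nonneg (integral_nonneg fun y => norm_nonneg _) (norm_nonneg _))]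
    exact mul_le_mul_of_nonneg_right (hgle x) (norm_nonneg _)
  have hAi : ∫ p, A p ∂μ.prod μ = dyadicEigenvalue D μ α Q * ∫ x, φ x * f x ∂μ := by
    rw [integral_prod _ hA, ← integral_const_mul]
    refine integral_congr_ae (.of_forall fun x => ?_)
    simp only [A, integral_mul_const, hφ.integral_sub_mul_kernel hX hD hα x]
    ring
  have he : (fun p : X × X => (φ p.1 - φ p.2) * dyadicKernel D μ (1 + α) p.1 p.2 *
      (f p.1 - f p.2)) = fun p => A p + A p.swap := by
    funext p
    simp only [A, Prod.fst_swap, Prod.snd_swap, dyadicKernel_comm (1 + α) p.2 p.1]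
    ring
  rw [he]
  refine ⟨hA.add hA.swap, ?_⟩
  have h2 : ∫ p : X × X, A p.swap ∂μ.prod μ = ∫ p, A p ∂μ.prod μ := integral_prod_swap A
  rw [integral_add hA (show Integrable (fun p => A p.swap) _ from hA.swap), h2, hAi]
  ring

end IsWavelet

end Wavelet

/-! ### Series along an orthogonal family -/

section Orthogonal

variable {E ι : Type*} [NormedAddCommGroup E] [InnerProductSpace ℂ E] {e : ι → E}

lemma orthonormal_normalize (he0 : ∀ i, e i ≠ 0)
    (he : Pairwise fun i j => inner ℂ (e i) (e j) = 0) :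
    Orthonormal ℂ fun i => ((‖e i‖⁻¹ : ℝ) : ℂ) • e i := by
  refine ⟨fun i => ?_, fun i j hij => ?_⟩
  · rw [norm_smul, Complex.norm_real, norm_inv, norm_norm,
      inv_mul_cancel₀ (norm_ne_zero_iff.2 (he0 i))]
  · simp only [inner_smul_left, inner_smul_right, he hij, mul_zero]

lemma smul_eq_smul_normalize (he0 : ∀ i, e i ≠ 0) (c : ι → ℂ) (i : ι) :
    c i • e i = (c i * (‖e i‖ : ℂ)) • (((‖e i‖⁻¹ : ℝ) : ℂ) • e i) := by
  have : (‖e i‖ : ℂ) ≠ 0 := Complex.ofReal_ne_zero.2 (norm_ne_zero_iff.2 (he0 i))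
  rw [smul_smul, Complex.ofReal_inv, mul_assoc, mul_inv_cancel₀ this, mul_one]

lemma summable_smul_of_orthogonal [CompleteSpace E] (he0 : ∀ i, e i ≠ 0)
    (he : Pairwise fun i j => inner ℂ (e i) (e j) = 0) {c : ι → ℂ}
    (hc : Summable fun i => ‖c i‖ ^ 2 * ‖e i‖ ^ 2) : Summable fun i => c i • e i := by
  have h := ((orthonormal_normalize he0 he).orthogonalFamily.summable_iff_norm_sq_summable
    (fun i => c i * (‖e i‖ : ℂ))).2 (by simpa [mul_pow] using hc)
  simp_rw [smul_eq_smul_normalize he0 c]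
  exact h

lemma hasSum_norm_sq_of_orthogonal (he0 : ∀ i, e i ≠ 0)
    (he : Pairwise fun i j => inner ℂ (e i) (e j) = 0) {c : ι → ℂ} {f : E}
    (hf : HasSum (fun i => c i • e i) f) : HasSum (fun i => ‖c i‖ ^ 2 * ‖e i‖ ^ 2) (‖f‖ ^ 2) := by
  have h : Tendsto (fun s : Finset ι => ‖∑ i ∈ s, c i • e i‖ ^ 2) atTop (𝓝 (‖f‖ ^ 2)) :=
    (Filter.Tendsto.norm hf).pow 2
  refine h.congr fun s => ?_
  have h1 := (orthonormal_normalize he0 he).orthogonalFamily.norm_sum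
    (fun i => c i * (‖e i‖ : ℂ)) s
  simp_rw [smul_eq_smul_normalize he0 c]
  simpa [mul_pow] using h1

lemma summable_inner_sq_div (he0 : ∀ i, e i ≠ 0)
    (he : Pairwise fun i j => inner ℂ (e i) (e j) = 0) (f : E) :
    Summable fun i => ‖inner ℂ (e i) f‖ ^ 2 / ‖e i‖ ^ 2 := by
  refine ((orthonormal_normalize he0 he).inner_products_summable f).congr fun i => ?_
  rw [inner_smul_left, norm_mul, mul_pow]
  simp
  ring

/-- Dominated convergence for sums along an orthogonal family. -/
lemma tendsto_of_hasSum_orthogonal (he0 : ∀ i, e i ≠ 0)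
    (he : Pairwise fun i j => inner ℂ (e i) (e j) = 0) {β : Type*} {l : Filter β}
    {a : β → ι → ℂ} {b : ι → ℂ} {F : β → E} {G : E} {B : ι → ℝ}
    (ha : ∀ᶠ t in l, HasSum (fun i => a t i • e i) (F t)) (hb : HasSum (fun i => b i • e i) G)
    (hB : Summable fun i => B i ^ 2 * ‖e i‖ ^ 2) (hle : ∀ᶠ t in l, ∀ i, ‖a t i - b i‖ ≤ B i)
    (hlim : ∀ i, Tendsto (fun t => a t i) l (𝓝 (b i))) : Tendsto F l (𝓝 G) := by
  rw [tendsto_iff_norm_sub_tendsto_zero]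
  have h2 : Tendsto (fun t => ∑' i, ‖a t i - b i‖ ^ 2 * ‖e i‖ ^ 2) l (𝓝 (∑' _ : ι, 0)) := by
    refine tendsto_tsum_of_dominated_convergence hB (fun i => ?_) ?_
    · have := ((tendsto_iff_norm_sub_tendsto_zero.1 (hlim i)).pow 2).mul_const (‖e i‖ ^ 2)
      simpa using this
    · filter_upwards [hle] with t ht i
      rw [Real.norm_of_nonneg (by positivity)]
      gcongr
      exact ht i
  rw [tsum_zero] at h2
  have h3 := h2.sqrt
  rw [Real.sqrt_zero] at h3
  refine h3.congr' ?_
  filter_upwards [ha] with t ht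
  have h4 : HasSum (fun i => (a t i - b i) • e i) (F t - G) := by
    simpa only [sub_smul] using ht.sub hb
  rw [(hasSum_norm_sq_of_orthogonal he0 he h4).tsum_eq, Real.sqrt_sq (norm_nonneg _)]

end Orthogonal

/-! ### The Haar system in `L²` -/

section HaarL2

variable {X : Type*} [MeasurableSpace X] {d : X → X → ℝ} {μ : Measure X} {D : ℤ → Set (Set X)}

namespace HaarSystem

lemma isWavelet (H : HaarSystem D μ) (h : H.carrier) :
    IsWavelet D μ (H.scale h) (H.cube h) fun x => (h.1 x : ℂ) where
  mem := H.cube_mem h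
  eq_zero x hx := by rw [H.eq_zero h x hx, Complex.ofReal_zero]
  const P hP := by
    obtain ⟨c, hc⟩ := H.const_on_offspring h P hP
    exact ⟨c, fun x hx => by rw [hc x hx]⟩
  integral := by rw [integral_complex_ofReal, H.integral_eq_zero, Complex.ofReal_zero]
  memLp := H.memLp h

lemma coeFn_toL2 (H : HaarSystem D μ) (h : H.carrier) : H.toL2 h =ᵐ[μ] fun x => (h.1 x : ℂ) :=
  (H.memLp h).coeFn_toLp

lemma inner_toL2 (H : HaarSystem D μ) (h : H.carrier) (f : Lp ℂ 2 μ) :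
    inner ℂ (H.toL2 h) f = ∫ x, (h.1 x : ℂ) * f x ∂μ := by
  rw [L2.inner_def]
  refine integral_congr_ae ?_
  filter_upwards [H.coeFn_toL2 h] with x hx
  rw [hx, RCLike.inner_apply, Complex.conj_ofReal, mul_comm]

lemma inner_toL2_toL2 (H : HaarSystem D μ) (h k : H.carrier) :
    inner ℂ (H.toL2 h) (H.toL2 k) = ((∫ x, h.1 x * k.1 x ∂μ : ℝ) : ℂ) := by
  rw [H.inner_toL2, ← integral_complex_ofReal]
  refine integral_congr_ae ?_
  filter_upwards [H.coeFn_toL2 k] with x hx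
  rw [hx]
  push_cast
  rfl

lemma integral_mul_eq_zero (hX : IsHomogeneousType d μ) (hD : IsDyadicFamily d μ D)
    (H : HaarSystem D μ) {h k : H.carrier} (hhk : h ≠ k) : ∫ x, h.1 x * k.1 x ∂μ = 0 := by
  have hdisj : ∀ {a b : H.carrier}, Disjoint (H.cube a) (H.cube b) → ∫ x, a.1 x * b.1 x ∂μ = 0 := by
    intro a b hab
    refine integral_eq_zero_of_ae (.of_forall fun x => ?_)
    by_cases hx : x ∈ H.cube a
    · simp [H.eq_zero b x (Set.disjoint_left.1 hab hx)]
    · simp [H.eq_zero a x hx]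
  have hlt : ∀ {a b : H.carrier}, H.scale a < H.scale b → ∫ x, a.1 x * b.1 x ∂μ = 0 := by
    intro a b hab
    rcases hD.nested _ _ hab.le _ (H.cube_mem b) _ (H.cube_mem a) with hs | hd
    · obtain ⟨P, hP, hbP⟩ := hD.exists_ancestor hX (show H.scale a + 1 ≤ H.scale b by omega)
        (H.cube_mem b)
      obtain ⟨x, hx⟩ := hD.nonempty hX (H.cube_mem b)
      obtain ⟨c, hc⟩ := H.const_on_offspring a P
        ⟨hP, hD.subset_of_mem (by omega) hP (H.cube_mem a) (hbP hx) (hs hx)⟩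
      have : (fun x => a.1 x * b.1 x) = fun x => c * b.1 x := by
        funext y
        by_cases hy : y ∈ H.cube b
        · rw [hc y (hbP hy)]
        · rw [H.eq_zero b y hy, mul_zero, mul_zero]
      rw [this, integral_const_mul, H.integral_eq_zero, mul_zero]
    · exact hdisj hd.symm
  rcases lt_trichotomy (H.scale h) (H.scale k) with hs | hs | hs
  · exact hlt hs
  · by_cases hc : H.cube h = H.cube k
    · exact H.orthogonal h k hs hc hhk
    · exact hdisj (hD.pairwiseDisjoint _ (H.cube_mem h) (hs ▸ H.cube_mem k) hc)
  · simp_rw [mul_comm (h.1 _)]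
    exact hlt hs

lemma orthonormal_toL2 (hX : IsHomogeneousType d μ) (hD : IsDyadicFamily d μ D)
    (H : HaarSystem D μ) : Orthonormal ℂ H.toL2 := by
  classical
  rw [orthonormal_iff_ite]
  intro h k
  rw [H.inner_toL2_toL2]
  split_ifs with hhk
  · subst hhk
    simp_rw [← sq]
    rw [H.integral_sq, Complex.ofReal_one]
  · rw [H.integral_mul_eq_zero hX hD hhk, Complex.ofReal_zero]

end HaarSystem

end HaarL2

/-! ### The Haar system in the Besov spaces -/

section HaarBesov

variable {X : Type*} [MeasurableSpace X] {d : X → X → ℝ} {μ : Measure X} {D : ℤ → Set (Set X)}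
  {σ : ℝ}

lemma exists_seq_tendsto_ae_of_tendsto_Lp {Y : Type*} [MeasurableSpace Y] {ν : Measure Y}
    {f : ℕ → Lp ℂ 2 ν} {g : Lp ℂ 2 ν} (h : Tendsto f atTop (𝓝 g)) :
    ∃ ns : ℕ → ℕ, StrictMono ns ∧ ∀ᵐ x ∂ν, Tendsto (fun i => f (ns i) x) atTop (𝓝 (g x)) :=
  (tendstoInMeasure_of_tendsto_Lp h).exists_seq_tendsto_ae

lemma besovQuotient_congr_ae [SFinite μ] {f g : X → ℂ} (h : f =ᵐ[μ] g) :
    besovQuotient D μ σ f =ᵐ[μ.prod μ] besovQuotient D μ σ g := by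
  filter_upwards [Measure.quasiMeasurePreserving_fst.ae h,
    Measure.quasiMeasurePreserving_snd.ae h] with p h1 h2
  rw [besovQuotient, h1, h2, besovQuotient]

lemma Besov.toL2_injective : Function.Injective (Besov.toL2 : Besov D μ σ → Lp ℂ 2 μ) :=
  Subtype.val_injective

lemma Besov.toL2_smul (c : ℂ) (f : Besov D μ σ) : (c • f).toL2 = c • f.toL2 := rfl

/-- `Besov.toL2` as a linear map. -/
def Besov.toL2Linear (D : ℤ → Set (Set X)) (μ : Measure X) (σ : ℝ) :
    Besov D μ σ →ₗ[ℂ] Lp ℂ 2 μ where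
  toFun := Besov.toL2
  map_add' _ _ := rfl
  map_smul' _ _ := rfl

lemma norm_besovEmbedding (f : Besov D μ σ) : ‖besovEmbedding D μ σ f‖ = ‖f‖ := rfl

lemma isometry_besovEmbedding : Isometry (besovEmbedding D μ σ) :=
  AddMonoidHomClass.isometry_of_norm _ norm_besovEmbedding

lemma Besov.norm_toL2_le (f : Besov D μ σ) : ‖f.toL2‖ ≤ ‖f‖ :=
  WithLp.norm_fst_le _ (besovEmbedding D μ σ f)

lemma Besov.norm_toLp_le (f : Besov D μ σ) :
    ‖(show MemLp (besovQuotient D μ σ f.toL2) 2 (μ.prod μ) from f.2).toLp‖ ≤ ‖f‖ :=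
  WithLp.norm_snd_le _ (besovEmbedding D μ σ f)

lemma Besov.continuous_toL2 : Continuous (Besov.toL2 : Besov D μ σ → Lp ℂ 2 μ) :=
  AddMonoidHomClass.continuous_of_bound (Besov.toL2Linear D μ σ) 1 fun f => by
    rw [one_mul]; exact f.norm_toL2_le

lemma Besov.hasSum_toL2 {ι : Type*} {F : ι → Besov D μ σ} {f : Besov D μ σ} (h : HasSum F f) :
    HasSum (fun i => (F i).toL2) f.toL2 :=
  h.map (Besov.toL2Linear D μ σ) Besov.continuous_toL2

/-- The range of the embedding is closed, that is, the Besov space is complete: along a subsequence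
that converges almost everywhere, the quotients converge to the quotient of the limit. -/
lemma isClosed_range_besovEmbedding [SFinite μ] (hX : IsHomogeneousType d μ)
    (hD : IsDyadicFamily d μ D) : IsClosed (Set.range (besovEmbedding D μ σ)) := by
  refine IsSeqClosed.isClosed fun F G hF hFG => ?_
  choose f hf using hF
  have h1 : Tendsto (fun n => (f n).toL2) atTop (𝓝 G.fst) := by
    have := ((WithLp.prod_continuous_ofLp 2 _ _).fst.tendsto G).comp hFG
    exact this.congr fun n => by rw [Function.comp, ← hf]; rfl
  have h2 : Tendsto (fun n => MemLp.toLp _ (f n).2) atTop (𝓝 G.snd) := by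
    have := ((WithLp.prod_continuous_ofLp 2 _ _).snd.tendsto G).comp hFG
    exact this.congr fun n => by rw [Function.comp, ← hf]; rfl
  obtain ⟨ns, hns, h3⟩ := exists_seq_tendsto_ae_of_tendsto_Lp h1
  obtain ⟨ms, hms, h4⟩ := exists_seq_tendsto_ae_of_tendsto_Lp (h2.comp hns.tendsto_atTop)
  have h5 : ∀ᵐ p ∂μ.prod μ, ∀ n, MemLp.toLp _ (f n).2 p = besovQuotient D μ σ (f n).toL2 p :=
    ae_all_iff.2 fun n => (f n).2.coeFn_toLp
  have h6 : besovQuotient D μ σ G.fst =ᵐ[μ.prod μ] G.snd := by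
    filter_upwards [Measure.quasiMeasurePreserving_fst.ae h3,
      Measure.quasiMeasurePreserving_snd.ae h3, h4, h5] with p hp1 hp2 hp4 hp5
    refine tendsto_nhds_unique ?_ hp4
    simp only [Function.comp_apply, hp5, hD.besovQuotient_eq hX]
    exact ((hp1.sub hp2).mul_const _).comp hms.tendsto_atTop
  have h7 : MemLp (besovQuotient D μ σ G.fst) 2 (μ.prod μ) :=
    (memLp_congr_ae h6).2 (Lp.memLp G.snd)
  refine ⟨⟨G.fst, h7⟩, ?_⟩
  refine (WithLp.ofLp_injective 2) (Prod.ext rfl ?_)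
  exact (Lp.ext ((h7.coeFn_toLp).trans h6))

lemma hasSum_besovEmbedding_iff {ι : Type*} {F : ι → Besov D μ σ} {f : Besov D μ σ} :
    HasSum (fun i => besovEmbedding D μ σ (F i)) (besovEmbedding D μ σ f) ↔ HasSum F f :=
  isometry_besovEmbedding.isUniformInducing.isInducing.hasSum_iff F f

namespace HaarSystem

lemma weight_pos (hX : IsHomogeneousType d μ) (hD : IsDyadicFamily d μ D)
    (H : HaarSystem D μ) (h : H.carrier) :
    0 < 1 + 2 * dyadicEigenvalue D μ (2 * σ) (H.cube h) := by
  have := hD.dyadicEigenvalue_pos hX (2 * σ) (H.cube_mem h)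
  linarith

variable [SFinite μ]

lemma memLp_besovQuotient (hX : IsHomogeneousType d μ) (hD : IsDyadicFamily d μ D)
    (H : HaarSystem D μ) (hσ : 0 < σ) (h : H.carrier) :
    MemLp (besovQuotient D μ σ (H.toL2 h)) 2 (μ.prod μ) := by
  rw [memLp_congr_ae (besovQuotient_congr_ae (H.coeFn_toL2 h))]
  have hw := H.isWavelet h
  have hm : AEStronglyMeasurable (besovQuotient D μ σ fun x => (h.1 x : ℂ)) (μ.prod μ) := by
    have h1 := hw.memLp.aestronglyMeasurable
    rw [show besovQuotient D μ σ (fun x => (h.1 x : ℂ)) = _ from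
      funext (hD.besovQuotient_eq hX σ _)]
    refine (h1.comp_fst.sub h1.comp_snd).mul ?_
    exact (Complex.measurable_ofReal.comp
      (hD.measurable_dyadicKernel hX _)).aestronglyMeasurable
  rw [memLp_two_iff_integrable_sq_norm hm]
  refine ((hw.integral_prod_sub_mul hX hD (show 0 < 2 * σ by linarith) hw.memLp).1.norm).congr
    (.of_forall fun p => ?_)
  simp only
  rw [hD.besovQuotient_eq hX, ← dyadicKernel_half_mul_half]
  push_cast
  simp only [norm_mul]
  ring

/-- A Haar wavelet as an element of the Besov space. -/
noncomputable def toBesov (hX : IsHomogeneousType d μ) (hD : IsDyadicFamily d μ D)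
    (H : HaarSystem D μ) (hσ : 0 < σ) (h : H.carrier) : Besov D μ σ :=
  ⟨H.toL2 h, H.memLp_besovQuotient hX hD hσ h⟩

lemma toL2_toBesov (hX : IsHomogeneousType d μ) (hD : IsDyadicFamily d μ D) (H : HaarSystem D μ)
    (hσ : 0 < σ) (h : H.carrier) : (H.toBesov hX hD hσ h).toL2 = H.toL2 h := rfl

/-- The inner product of the Besov space with a wavelet is a multiple of that of `L²`. -/
lemma inner_besovEmbedding (hX : IsHomogeneousType d μ) (hD : IsDyadicFamily d μ D)
    (H : HaarSystem D μ) (hσ : 0 < σ) (h : H.carrier) (f : Besov D μ σ) :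
    inner ℂ (besovEmbedding D μ σ (H.toBesov hX hD hσ h)) (besovEmbedding D μ σ f) =
      (1 + 2 * dyadicEigenvalue D μ (2 * σ) (H.cube h) : ℝ) * inner ℂ (H.toL2 h) f.toL2 := by
  have hw := H.isWavelet h
  have h1 : inner ℂ (MemLp.toLp _ (H.toBesov hX hD hσ h).2) (MemLp.toLp _ f.2) =
      2 * dyadicEigenvalue D μ (2 * σ) (H.cube h) * ∫ x, (h.1 x : ℂ) * f.toL2 x ∂μ := by
    rw [← (hw.integral_prod_sub_mul hX hD (show 0 < 2 * σ by linarith) (Lp.memLp f.toL2)).2,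
      L2.inner_def]
    refine integral_congr_ae ?_
    filter_upwards [(H.toBesov hX hD hσ h).2.coeFn_toLp, f.2.coeFn_toLp,
      besovQuotient_congr_ae (σ := σ) (D := D) (H.coeFn_toL2 h)] with p hp1 hp2 hp3
    rw [hp1, hp2]
    change inner ℂ (besovQuotient D μ σ (H.toL2 h) p) (besovQuotient D μ σ f.toL2 p) = _
    rw [hp3, hD.besovQuotient_eq hX, hD.besovQuotient_eq hX, RCLike.inner_apply,
      ← dyadicKernel_half_mul_half (1 + 2 * σ)]
    simp only [map_mul, map_sub, Complex.conj_ofReal]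
    push_cast
    ring
  rw [WithLp.prod_inner_apply]
  change inner ℂ (H.toL2 h) f.toL2 + inner ℂ (MemLp.toLp _ (H.toBesov hX hD hσ h).2)
    (MemLp.toLp _ f.2) = _
  rw [h1, H.inner_toL2]
  push_cast
  ring

lemma norm_sq_toBesov (hX : IsHomogeneousType d μ) (hD : IsDyadicFamily d μ D)
    (H : HaarSystem D μ) (hσ : 0 < σ) (h : H.carrier) :
    ‖besovEmbedding D μ σ (H.toBesov hX hD hσ h)‖ ^ 2 =
      1 + 2 * dyadicEigenvalue D μ (2 * σ) (H.cube h) := by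
  have h1 := H.inner_besovEmbedding hX hD hσ h (H.toBesov hX hD hσ h)
  rw [toL2_toBesov, inner_self_eq_norm_sq_to_K, inner_self_eq_norm_sq_to_K,
    (H.orthonormal_toL2 hX hD).1 h] at h1
  simp only [Complex.coe_algebraMap, Complex.ofReal_one, one_pow, mul_one] at h1
  exact_mod_cast h1

lemma besovEmbedding_ne_zero (hX : IsHomogeneousType d μ) (hD : IsDyadicFamily d μ D)
    (H : HaarSystem D μ) (hσ : 0 < σ) (h : H.carrier) :
    besovEmbedding D μ σ (H.toBesov hX hD hσ h) ≠ 0 := by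
  intro h0
  have h1 := H.norm_sq_toBesov hX hD hσ h
  rw [h0, norm_zero] at h1
  have := H.weight_pos hX hD (σ := σ) h
  linarith

lemma pairwise_besovEmbedding (hX : IsHomogeneousType d μ) (hD : IsDyadicFamily d μ D)
    (H : HaarSystem D μ) (hσ : 0 < σ) :
    Pairwise fun h k => inner ℂ (besovEmbedding D μ σ (H.toBesov hX hD hσ h))
      (besovEmbedding D μ σ (H.toBesov hX hD hσ k)) = 0 := by
  intro h k hhk
  rw [H.inner_besovEmbedding, toL2_toBesov, (H.orthonormal_toL2 hX hD).2 hhk, mul_zero]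

/-- Bessel's inequality in the Besov space. -/
lemma summable_weight_mul_inner_sq (hX : IsHomogeneousType d μ) (hD : IsDyadicFamily d μ D)
    (H : HaarSystem D μ) (hσ : 0 < σ) (f : Besov D μ σ) :
    Summable fun h => ‖inner ℂ (H.toL2 h) f.toL2‖ ^ 2 *
      (1 + 2 * dyadicEigenvalue D μ (2 * σ) (H.cube h)) := by
  refine (summable_inner_sq_div (H.besovEmbedding_ne_zero hX hD hσ)
    (H.pairwise_besovEmbedding hX hD hσ) (besovEmbedding D μ σ f)).congr fun h => ?_
  have h1 := H.weight_pos hX hD (σ := σ) h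
  rw [H.norm_sq_toBesov, H.inner_besovEmbedding, norm_mul, Complex.norm_real,
    Real.norm_of_nonneg h1.le]
  field_simp

lemma exists_hasSum_besov (hX : IsHomogeneousType d μ) (hD : IsDyadicFamily d μ D)
    (H : HaarSystem D μ) (hσ : 0 < σ) {c : H.carrier → ℂ}
    (hc : Summable fun h => ‖c h‖ ^ 2 * (1 + 2 * dyadicEigenvalue D μ (2 * σ) (H.cube h))) :
    ∃ f : Besov D μ σ, HasSum (fun h => c h • H.toBesov hX hD hσ h) f := by
  simp_rw [← H.norm_sq_toBesov hX hD hσ] at hc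
  obtain ⟨g, hg⟩ := summable_smul_of_orthogonal (H.besovEmbedding_ne_zero hX hD hσ)
    (H.pairwise_besovEmbedding hX hD hσ) hc
  obtain ⟨f, rfl⟩ : g ∈ Set.range (besovEmbedding D μ σ) := by
    refine (isClosed_range_besovEmbedding hX hD).mem_of_tendsto hg (.of_forall fun s => ?_)
    exact ⟨∑ h ∈ s, c h • H.toBesov hX hD hσ h, by simp⟩
  refine ⟨f, hasSum_besovEmbedding_iff.1 ?_⟩
  simpa using hg

lemma tendsto_besov_of_hasSum (hX : IsHomogeneousType d μ) (hD : IsDyadicFamily d μ D)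
    (H : HaarSystem D μ) (hσ : 0 < σ) {β : Type*} {l : Filter β}
    {a : β → H.carrier → ℂ} {b : H.carrier → ℂ} {F : β → Besov D μ σ} {G : Besov D μ σ}
    {B : H.carrier → ℝ}
    (ha : ∀ᶠ t in l, HasSum (fun h => a t h • H.toBesov hX hD hσ h) (F t))
    (hb : HasSum (fun h => b h • H.toBesov hX hD hσ h) G)
    (hB : Summable fun h => B h ^ 2 * (1 + 2 * dyadicEigenvalue D μ (2 * σ) (H.cube h)))
    (hle : ∀ᶠ t in l, ∀ h, ‖a t h - b h‖ ≤ B h)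
    (hlim : ∀ h, Tendsto (fun t => a t h) l (𝓝 (b h))) : Tendsto F l (𝓝 G) := by
  rw [isometry_besovEmbedding.isUniformInducing.isInducing.tendsto_nhds_iff]
  simp_rw [← H.norm_sq_toBesov hX hD hσ] at hB
  refine tendsto_of_hasSum_orthogonal (H.besovEmbedding_ne_zero hX hD hσ)
    (H.pairwise_besovEmbedding hX hD hσ) (a := a) (b := b) ?_ ?_ hB hle hlim
  · filter_upwards [ha] with t ht
    simpa using hasSum_besovEmbedding_iff.2 ht
  · simpa using hasSum_besovEmbedding_iff.2 hb

end HaarSystem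

end HaarBesov

/-! ### Completeness of the Haar system -/

section Completeness

variable {X : Type*} [MeasurableSpace X] {d : X → X → ℝ} {μ : Measure X} {D : ℤ → Set (Set X)}

namespace IsDyadicFamily

/-- The class in `L²` of the indicator function of a cube. -/
noncomputable def indicatorL2 (hX : IsHomogeneousType d μ) (hD : IsDyadicFamily d μ D) {j : ℤ}
    {Q : Set X} (hQ : Q ∈ D j) : Lp ℂ 2 μ :=
  indicatorConstLp 2 (hD.measurableSet j Q hQ) (hD.measure_lt_top hX hQ).ne 1

lemma coeFn_indicatorL2 (hX : IsHomogeneousType d μ) (hD : IsDyadicFamily d μ D) {j : ℤ}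
    {Q : Set X} (hQ : Q ∈ D j) : hD.indicatorL2 hX hQ =ᵐ[μ] Q.indicator fun _ => (1 : ℂ) :=
  indicatorConstLp_coeFn

lemma indicatorL2_ne_zero (hX : IsHomogeneousType d μ) (hD : IsDyadicFamily d μ D) {j : ℤ}
    {Q : Set X} (hQ : Q ∈ D j) : hD.indicatorL2 hX hQ ≠ 0 := by
  intro h0
  have h := norm_indicatorConstLp (p := 2) (hs := hD.measurableSet j Q hQ)
    (hμs := (hD.measure_lt_top hX hQ).ne) (c := (1 : ℂ)) (by simp) (by simp)
  rw [show indicatorConstLp 2 _ _ (1 : ℂ) = 0 from h0, norm_zero, norm_one, one_mul] at h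
  exact (Real.rpow_pos_of_pos (hD.real_pos hX hQ) _).ne h

lemma inner_indicatorL2 (hX : IsHomogeneousType d μ) (hD : IsDyadicFamily d μ D) {j : ℤ}
    {Q : Set X} (hQ : Q ∈ D j) (f : Lp ℂ 2 μ) :
    inner ℂ (hD.indicatorL2 hX hQ) f = ∫ x in Q, f x ∂μ :=
  L2.inner_indicatorConstLp_one _ _ f

/-- A function on `Q` that is constant on each child is a combination of the indicator functions
of the children. -/
lemma mem_span_indicatorL2 (hX : IsHomogeneousType d μ) (hD : IsDyadicFamily d μ D) {j : ℤ}
    {Q : Set X} (hQ : Q ∈ D j) {g : Lp ℂ 2 μ} {φ : X → ℂ} (hg : g =ᵐ[μ] φ)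
    (h0 : ∀ x ∉ Q, φ x = 0) (hc : ∀ P ∈ offspring D j Q, ∃ c : ℂ, ∀ x ∈ P, φ x = c) :
    g ∈ Submodule.span ℂ
      (Set.range fun P : offspring D j Q => hD.indicatorL2 hX P.2.1) := by
  have := (hD.offspring_finite hX hQ).fintype
  have hc' : ∀ P : offspring D j Q, ∃ c : ℂ, ∀ x ∈ P.1, φ x = c := fun P => hc P P.2
  choose c hc' using hc'
  have hsum : g = ∑ P : offspring D j Q, c P • hD.indicatorL2 hX P.2.1 := by
    refine Lp.ext ?_
    have e1 : ∀ᵐ x ∂μ, ∀ P : offspring D j Q,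
        (c P • hD.indicatorL2 hX P.2.1) x = c P * P.1.indicator (fun _ => (1 : ℂ)) x := by
      refine ae_all_iff.2 fun P => ?_
      filter_upwards [Lp.coeFn_smul (c P) (hD.indicatorL2 hX P.2.1),
        hD.coeFn_indicatorL2 hX P.2.1] with x h1 h2
      rw [h1, Pi.smul_apply, h2, smul_eq_mul]
    filter_upwards [hg, e1, hD.ae_forall_mem, Lp.coeFn_finsetSum Finset.univ
      (fun P : offspring D j Q => c P • hD.indicatorL2 hX P.2.1)] with x hx1 hx2 hx3 hx4
    rw [hx1, hx4, Finset.sum_apply]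
    simp only [hx2]
    by_cases hxQ : x ∈ Q
    · obtain ⟨P, hP, hxP⟩ := hD.exists_offspring hQ hxQ hx3
      rw [Finset.sum_eq_single ⟨P, hP⟩, Set.indicator_of_mem hxP, mul_one, hc' ⟨P, hP⟩ x hxP]
      · intro R _ hR
        rw [Set.indicator_of_notMem, mul_zero]
        exact fun hxR => hR (Subtype.ext (hD.eq_of_mem R.2.1 hP.1 hxR hxP))
      · simp
    · rw [h0 x hxQ, Finset.sum_eq_zero]
      intro R _
      rw [Set.indicator_of_notMem fun hxR => hxQ (R.2.2 hxR), mul_zero]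
  rw [hsum]
  exact Submodule.sum_mem _ fun P _ => Submodule.smul_mem _ _ (Submodule.subset_span ⟨P, rfl⟩)

end IsDyadicFamily

/-- By counting dimensions, the wavelets based on `Q` and the indicator function of `Q` span the
indicator functions of the children of `Q`. -/
lemma HaarSystem.setIntegral_offspring_eq_zero (hX : IsHomogeneousType d μ)
    (hD : IsDyadicFamily d μ D) (H : HaarSystem D μ) {f : Lp ℂ 2 μ}
    (hf : ∀ h, inner ℂ (H.toL2 h) f = 0) {j : ℤ} {Q : Set X} (hQ : Q ∈ D j)
    (hfQ : ∫ x in Q, f x ∂μ = 0) {P : Set X} (hP : P ∈ offspring D j Q) :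
    ∫ x in P, f x ∂μ = 0 := by
  have hfin := hD.offspring_finite hX hQ
  have := hfin.fintype
  let B : Set H.carrier := {h | H.scale h = j ∧ H.cube h = Q}
  have hB : B.encard + 1 = (offspring D j Q).encard := H.card_based j Q hQ
  have hBfin : B.Finite := by
    rw [← Set.encard_lt_top_iff]
    refine lt_of_le_of_lt le_self_add (hB.trans_lt hfin.encard_lt_top)
  have := hBfin.fintype
  let v : Option B → Lp ℂ 2 μ := fun o => o.elim (hD.indicatorL2 hX hQ) fun h => H.toL2 h
  let S := Submodule.span ℂ (Set.range fun P : offspring D j Q => hD.indicatorL2 hX P.2.1)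
  have hQh : ∀ h : B, inner ℂ (hD.indicatorL2 hX hQ) (H.toL2 h) = 0 := by
    intro h
    obtain ⟨h, hj, rfl⟩ := h
    have hw := H.isWavelet h
    rw [hD.inner_indicatorL2, ← hw.integral, ← setIntegral_eq_integral_of_forall_compl_eq_zero
      hw.eq_zero]
    exact integral_congr_ae (ae_restrict_of_ae (H.coeFn_toL2 h))
  have hvS : ∀ o, v o ∈ S := by
    rintro (_ | ⟨h, rfl, rfl⟩)
    · refine hD.mem_span_indicatorL2 hX hQ (hD.coeFn_indicatorL2 hX hQ)
        (fun x hx => Set.indicator_of_notMem hx _)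
        fun R hR => ⟨1, fun x hx => Set.indicator_of_mem (hR.2 hx) _⟩
    · exact hD.mem_span_indicatorL2 hX hQ (H.coeFn_toL2 h) (H.isWavelet h).eq_zero
        (H.isWavelet h).const
  have hli : LinearIndependent ℂ v := by
    have hon := H.orthonormal_toL2 hX hD
    refine linearIndependent_of_ne_zero_of_inner_eq_zero ?_ ?_
    · rintro (_ | h)
      · exact hD.indicatorL2_ne_zero hX hQ
      · exact hon.ne_zero _
    · rintro (_ | h) (_ | k) hhk
      · exact absurd rfl hhk
      · exact hQh k
      · exact inner_eq_zero_symm.1 (hQh h)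
      · exact hon.2 fun e => hhk (congrArg some (Subtype.ext e))
  have hcard : Fintype.card (offspring D j Q) = Fintype.card (Option B) := by
    rw [Fintype.card_option]
    rw [← Set.coe_fintypeCard, ← Set.coe_fintypeCard] at hB
    exact_mod_cast hB.symm
  have hfd : FiniteDimensional ℂ S := FiniteDimensional.span_of_finite ℂ (Set.finite_range _)
  have hspan : Submodule.span ℂ (Set.range v) = S := by
    refine Submodule.eq_of_le_of_finrank_le (Submodule.span_le.2 ?_) ?_
    · rintro _ ⟨o, rfl⟩
      exact hvS o
    · rw [finrank_span_eq_card hli, ← hcard]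
      exact finrank_range_le_card _
  have hmem : hD.indicatorL2 hX hP.1 ∈ Submodule.span ℂ (Set.range v) := by
    rw [hspan]
    exact Submodule.subset_span ⟨⟨P, hP⟩, rfl⟩
  rw [← hD.inner_indicatorL2 hX hP.1]
  generalize hD.indicatorL2 hX hP.1 = g at hmem
  induction hmem using Submodule.span_induction with
  | mem x hx =>
    obtain ⟨_ | h, rfl⟩ := hx
    · exact (hD.inner_indicatorL2 hX hQ f).trans hfQ
    · exact hf h
  | zero => exact inner_zero_left _
  | add x y _ _ hx hy => rw [inner_add_left, hx, hy, add_zero]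
  | smul a x _ hx => rw [inner_smul_left, hx, mul_zero]

namespace IsDyadicFamily

/-- The cubes of non-negative scale. -/
def fineCubes (D : ℤ → Set (Set X)) : Set (Set X) := {Q | ∃ n : ℕ, Q ∈ D n}

lemma isPiSystem_fineCubes (hD : IsDyadicFamily d μ D) : IsPiSystem (fineCubes D) := by
  rintro P ⟨m, hP⟩ Q ⟨n, hQ⟩ ⟨x, hxP, hxQ⟩
  rcases le_total (m : ℤ) n with h | h
  · rw [Set.inter_eq_right.2 (hD.subset_of_mem h hQ hP hxQ hxP)]
    exact ⟨n, hQ⟩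
  · rw [Set.inter_eq_left.2 (hD.subset_of_mem h hP hQ hxP hxQ)]
    exact ⟨m, hP⟩

lemma measurableSet_of_generateFrom_fineCubes (hD : IsDyadicFamily d μ D) {t : Set X}
    (ht : MeasurableSet[MeasurableSpace.generateFrom (fineCubes D)] t) : MeasurableSet t :=
  MeasurableSpace.generateFrom_le (fun Q hQ => hQ.elim fun n hn => hD.measurableSet n Q hn) t ht

/-- Small cubes lie in small balls. -/
lemma exists_subset_ball (hX : IsHomogeneousType d μ) (hD : IsDyadicFamily d μ D) {x : X} {r : ℝ}
    (hr : 0 < r) : ∃ n : ℕ, ∀ Q ∈ D n, x ∈ Q → Q ⊆ quasiBall d x r := by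
  obtain ⟨Λ, a₁, a₂, hΛ, hΛ1, h1, h2, h⟩ := hD.size
  obtain ⟨K, hK⟩ := hX.dist_triangle
  obtain ⟨n, hn⟩ := exists_pow_lt_of_lt_one (show 0 < r / ((|K| + 1) * (2 * a₂)) by positivity) hΛ1
  rw [lt_div_iff₀ (by positivity)] at hn
  refine ⟨n, fun Q hQ hxQ y hyQ => ?_⟩
  obtain ⟨z, -, -, hz⟩ := h n Q hQ
  have e1 : d z x < a₂ * Λ ^ n := by
    rw [← zpow_natCast]
    exact hz hxQ
  have e2 : d z y < a₂ * Λ ^ n := by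
    rw [← zpow_natCast]
    exact hz hyQ
  have e3 := hK x z y
  rw [hX.dist_symm x z] at e3
  have n1 := hX.dist_nonneg z x
  have n2 := hX.dist_nonneg z y
  have e5 : K * (d z x + d z y) ≤ (|K| + 1) * (2 * a₂ * Λ ^ n) := by
    refine mul_le_mul (by linarith [le_abs_self K]) ?_ (by positivity) (by positivity)
    linarith
  change d x y < r
  nlinarith

/-- Up to null sets every measurable set belongs to the `σ`-algebra generated by the fine cubes:
an open set is almost everywhere the union of the countably many fine cubes that it contains. -/
lemma exists_generateFrom_fineCubes_ae_eq [SFinite μ] (hX : IsHomogeneousType d μ)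
    (hD : IsDyadicFamily d μ D) {s : Set X} (hs : MeasurableSet s) :
    ∃ t, MeasurableSet[MeasurableSpace.generateFrom (fineCubes D)] t ∧ s =ᵐ[μ] t := by
  obtain ⟨b, hb, hsb⟩ := hX.borel_regular s hs
  suffices ∃ t, MeasurableSet[MeasurableSpace.generateFrom (fineCubes D)] t ∧ b =ᵐ[μ] t by
    obtain ⟨t, ht, hbt⟩ := this
    exact ⟨t, ht, hsb.trans hbt⟩
  clear hsb hs
  induction b, hb using MeasurableSpace.generateFrom_induction with
  | hC o ho _ =>
    have ho : IsQuasiOpen d o := ho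
    refine ⟨⋃₀ {Q ∈ fineCubes D | Q ⊆ o}, ?_, ?_⟩
    · refine @MeasurableSet.sUnion _ (_) _ ?_ fun Q hQ =>
        MeasurableSpace.measurableSet_generateFrom hQ.1
      refine (Set.countable_iUnion fun n : ℕ => hD.countable hX n).mono fun Q hQ => ?_
      obtain ⟨⟨n, hn⟩, -⟩ := hQ
      exact Set.mem_iUnion.2 ⟨n, hn⟩
    · filter_upwards [hD.ae_forall_mem] with x hx
      refine propext ⟨fun hxo => ?_, fun ⟨Q, hQ, hxQ⟩ => hQ.2 hxQ⟩
      obtain ⟨r, hr, hro⟩ := ho x hxo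
      obtain ⟨n, hn⟩ := hD.exists_subset_ball hX hr (x := x)
      obtain ⟨Q, hQ, hxQ⟩ := hx n
      exact ⟨Q, ⟨⟨n, hQ⟩, (hn Q hQ hxQ).trans hro⟩, hxQ⟩
  | empty => exact ⟨∅, @MeasurableSet.empty _ (_), ae_eq_refl _⟩
  | compl t _ ih =>
    obtain ⟨u, hu, htu⟩ := ih
    exact ⟨uᶜ, @MeasurableSet.compl _ _ (_) hu, ae_eq_set_compl_compl.2 htu⟩
  | iUnion t _ ih =>
    choose u hu htu using ih
    exact ⟨⋃ n, u n, @MeasurableSet.iUnion _ _ (_) _ _ hu, Filter.EventuallyEq.countable_iUnion htu⟩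

/-- A function in `L²` whose integral over each fine cube vanishes is zero. -/
lemma eq_zero_of_setIntegral_fineCubes [SFinite μ] (hX : IsHomogeneousType d μ)
    (hD : IsDyadicFamily d μ D) {f : Lp ℂ 2 μ}
    (hf : ∀ n : ℕ, ∀ Q ∈ D n, ∫ x in Q, f x ∂μ = 0) : f = 0 := by
  have hcube : ∀ Q ∈ D 0, ∀ᵐ x ∂μ.restrict Q, f x = 0 := by
    intro Q hQ
    have hfin : IsFiniteMeasure (μ.restrict Q) := ⟨by simpa using hD.measure_lt_top hX hQ⟩
    have hi : IntegrableOn f Q μ := ((Lp.memLp f).restrict Q).integrable (by norm_num)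
    have key : ∀ t, MeasurableSet[MeasurableSpace.generateFrom (fineCubes D)] t →
        ∫ x in t, f x ∂μ.restrict Q = 0 := by
      intro t ht
      induction t, ht using MeasurableSpace.induction_on_inter with
      | h_eq => rfl
      | h_inter => exact hD.isPiSystem_fineCubes
      | empty => simp
      | basic P hP =>
        obtain ⟨n, hP⟩ := hP
        rw [Measure.restrict_restrict (hD.measurableSet n P hP)]
        rcases hD.nested 0 n (by omega) P hP Q hQ with h | h
        · rw [Set.inter_eq_left.2 h]
          exact hf n P hP
        · rw [Set.disjoint_iff_inter_eq_empty.1 h]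
          simp
      | compl t ht ih =>
        have h1 := integral_add_compl (hD.measurableSet_of_generateFrom_fineCubes ht) hi
        rwa [ih, zero_add, hf 0 Q hQ] at h1
      | iUnion t hd ht ih =>
        rw [integral_iUnion (fun n => hD.measurableSet_of_generateFrom_fineCubes (ht n)) hd
          (Integrable.integrableOn hi)]
        simp [ih]
    refine Integrable.ae_eq_zero_of_forall_setIntegral_eq_zero hi fun s hs _ => ?_
    obtain ⟨t, ht, hst⟩ := hD.exists_generateFrom_fineCubes_ae_eq hX hs
    rw [setIntegral_congr_set (ae_restrict_of_ae hst), key t ht]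
  refine Lp.eq_zero_iff_ae_eq_zero.2 ?_
  have h1 := (ae_restrict_biUnion_iff (fun Q => Q) (hD.countable hX 0) fun x => f x = 0).2 hcube
  rw [ae_restrict_iff' (MeasurableSet.biUnion (hD.countable hX 0)
    fun Q hQ => hD.measurableSet 0 Q hQ)] at h1
  filter_upwards [h1, hD.ae_forall_mem] with x hx1 hx2
  obtain ⟨Q, hQ, hxQ⟩ := hx2 0
  exact hx1 (Set.mem_biUnion hQ hxQ)

end IsDyadicFamily

namespace HaarSystem

/-- A function in `L²` that is orthogonal to the Haar system and to `V_0` is zero. -/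
lemma eq_zero_of_inner_eq_zero [SFinite μ] (hX : IsHomogeneousType d μ)
    (hD : IsDyadicFamily d μ D) (H : HaarSystem D μ) {f : Lp ℂ 2 μ}
    (hf : ∀ h, inner ℂ (H.toL2 h) f = 0) (hf0 : ∀ Q ∈ D 0, ∫ x in Q, f x ∂μ = 0) : f = 0 := by
  refine hD.eq_zero_of_setIntegral_fineCubes hX fun n => ?_
  induction n with
  | zero => exact hf0
  | succ n ih =>
    intro P hP
    obtain ⟨Q, hQ, hPQ⟩ := hD.exists_ancestor hX (show (n : ℤ) ≤ (n + 1 : ℕ) by simp) hP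
    exact H.setIntegral_offspring_eq_zero hX hD hf hQ (ih Q hQ) ⟨by exact_mod_cast hP, hPQ⟩

lemma _root_.IsDyadicFamily.indicatorL2_mem_dyadicConst (hX : IsHomogeneousType d μ)
    (hD : IsDyadicFamily d μ D) {j : ℤ}
    {Q : Set X} (hQ : Q ∈ D j) : hD.indicatorL2 hX hQ ∈ dyadicConst D μ j := by
  intro P hP
  have h1 : ∀ᵐ x ∂μ.restrict P, hD.indicatorL2 hX hQ x = Q.indicator (fun _ => (1 : ℂ)) x :=
    ae_restrict_of_ae (hD.coeFn_indicatorL2 hX hQ)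
  by_cases hPQ : P = Q
  · refine ⟨1, ?_⟩
    filter_upwards [h1, ae_restrict_mem (hD.measurableSet j P hP)] with x hx hxP
    rw [hx, Set.indicator_of_mem (hPQ ▸ hxP)]
  · refine ⟨0, ?_⟩
    filter_upwards [h1, ae_restrict_mem (hD.measurableSet j P hP)] with x hx hxP
    rw [hx, Set.indicator_of_notMem fun hxQ => hPQ (hD.eq_of_mem hP hQ hxP hxQ)]

/-- The wavelets based on cubes of scale less than `j` belong to `V_j`. -/
lemma toL2_mem_dyadicConst (hX : IsHomogeneousType d μ) (hD : IsDyadicFamily d μ D)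
    (H : HaarSystem D μ) {h : H.carrier} {j : ℤ} (hj : H.scale h < j) :
    H.toL2 h ∈ dyadicConst D μ j := by
  intro P hP
  have h1 : ∀ᵐ x ∂μ.restrict P, H.toL2 h x = (h.1 x : ℂ) := ae_restrict_of_ae (H.coeFn_toL2 h)
  suffices ∃ c : ℂ, ∀ x ∈ P, (h.1 x : ℂ) = c by
    obtain ⟨c, hc⟩ := this
    refine ⟨c, ?_⟩
    filter_upwards [h1, ae_restrict_mem (hD.measurableSet j P hP)] with x hx hxP
    rw [hx, hc x hxP]
  rcases hD.nested _ _ hj.le P hP _ (H.cube_mem h) with hs | hd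
  · obtain ⟨R, hR, hPR⟩ := hD.exists_ancestor hX (show H.scale h + 1 ≤ j by omega) hP
    obtain ⟨x, hx⟩ := hD.nonempty hX hP
    obtain ⟨c, hc⟩ := (H.isWavelet h).const R
      ⟨hR, hD.subset_of_mem (by omega) hR (H.cube_mem h) (hPR hx) (hs hx)⟩
    exact ⟨c, fun y hy => hc y (hPR hy)⟩
  · exact ⟨0, fun x hx => (H.isWavelet h).eq_zero x (Set.disjoint_left.1 hd hx)⟩

/-- The wavelets based on cubes of scale at least `j` have mean zero on the cubes of scale `j`. -/
lemma inner_indicatorL2_toL2 (hX : IsHomogeneousType d μ) (hD : IsDyadicFamily d μ D)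
    (H : HaarSystem D μ) {h : H.carrier} {j : ℤ} (hj : j ≤ H.scale h) {Q : Set X} (hQ : Q ∈ D j) :
    inner ℂ (hD.indicatorL2 hX hQ) (H.toL2 h) = 0 := by
  have hw := H.isWavelet h
  have h1 : ∫ x in Q, H.toL2 h x ∂μ = ∫ x in Q, (h.1 x : ℂ) ∂μ :=
    integral_congr_ae (ae_restrict_of_ae (H.coeFn_toL2 h))
  rw [hD.inner_indicatorL2, h1]
  rcases hD.nested _ _ hj _ (H.cube_mem h) Q hQ with hs | hd
  · rw [setIntegral_eq_integral_of_forall_compl_eq_zero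
      fun x hx => hw.eq_zero x fun hx' => hx (hs hx'), hw.integral]
  · refine setIntegral_eq_zero_of_forall_eq_zero fun x hx =>
      hw.eq_zero x (Set.disjoint_right.1 hd hx)

/-- The Haar expansion of a function orthogonal to `V_0`. -/
lemma hasSum_inner_smul_toL2 [SFinite μ] (hX : IsHomogeneousType d μ)
    (hD : IsDyadicFamily d μ D) (H : HaarSystem D μ) {f : Lp ℂ 2 μ}
    (hf : f ∈ (dyadicConst D μ 0)ᗮ) :
    HasSum (fun h => inner ℂ (H.toL2 h) f • H.toL2 h) f := by
  have hon := H.orthonormal_toL2 hX hD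
  obtain ⟨g, hg⟩ := (hon.orthogonalFamily.summable_iff_norm_sq_summable
    (fun h => inner ℂ (H.toL2 h) f)).2 (hon.inner_products_summable f)
  have hg : HasSum (fun h => inner ℂ (H.toL2 h) f • H.toL2 h) g := hg
  have hin : ∀ k : Lp ℂ 2 μ,
      HasSum (fun h => inner ℂ (H.toL2 h) f * inner ℂ k (H.toL2 h)) (inner ℂ k g) := by
    intro k
    simpa only [innerSL_apply_apply, map_smul, smul_eq_mul] using hg.mapL (innerSL ℂ k)
  have hfg : f - g = 0 := by
    refine H.eq_zero_of_inner_eq_zero hX hD (fun k => ?_) fun Q hQ => ?_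
    · have h1 := (hin (H.toL2 k)).unique (hasSum_single k fun h hhk => by
        rw [hon.2 hhk.symm, mul_zero])
      rw [inner_sub_right, h1, inner_self_eq_norm_sq_to_K, hon.1 k]
      simp
    · rw [← hD.inner_indicatorL2 hX hQ, inner_sub_right,
        hf _ (hD.indicatorL2_mem_dyadicConst hX hQ), zero_sub, neg_eq_zero]
      refine (hin _).unique ?_
      convert hasSum_zero using 1
      funext h
      rcases lt_or_ge (H.scale h) 0 with hs | hs
      · rw [hf _ (H.toL2_mem_dyadicConst hX hD hs), zero_mul]
      · rw [H.inner_indicatorL2_toL2 hX hD hs hQ, mul_zero]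
  rw [sub_eq_zero] at hfg
  rwa [← hfg] at hg

end HaarSystem

end Completeness

/-! ### The fractional derivative on the Besov spaces -/

section FracDeriv

variable {X : Type*} [MeasurableSpace X] {d : X → X → ℝ} {μ : Measure X} {D : ℤ → Set (Set X)}
  {β σ : ℝ}

lemma HasFracDeriv.congr {f f' g g' : X → ℂ} (h : HasFracDeriv D μ β f g) (hf : f =ᵐ[μ] f')
    (hg : g =ᵐ[μ] g') : HasFracDeriv D μ β f' g' := by
  filter_upwards [h, hf, hg] with x hx hfx hgx
  have he : (fun y => (f x - f y) / ((dyadicDist D μ x y ^ (1 + β) : ℝ) : ℂ)) =ᵐ[μ]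
      fun y => (f' x - f' y) / ((dyadicDist D μ x y ^ (1 + β) : ℝ) : ℂ) := by
    filter_upwards [hf] with y hy
    rw [hfx, hy]
  exact ⟨hx.1.congr he, by rw [← integral_congr_ae he, hx.2, hgx]⟩

lemma HasFracDeriv.add {f f' g g' : X → ℂ} (h : HasFracDeriv D μ β f g)
    (h' : HasFracDeriv D μ β f' g') : HasFracDeriv D μ β (f + f') (g + g') := by
  filter_upwards [h, h'] with x hx hx'
  have he : (fun y => ((f + f') x - (f + f') y) / ((dyadicDist D μ x y ^ (1 + β) : ℝ) : ℂ)) =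
      fun y => (f x - f y) / ((dyadicDist D μ x y ^ (1 + β) : ℝ) : ℂ) +
        (f' x - f' y) / ((dyadicDist D μ x y ^ (1 + β) : ℝ) : ℂ) := by
    funext y
    simp only [Pi.add_apply]
    ring
  rw [he]
  exact ⟨hx.1.add hx'.1, by rw [integral_add hx.1 hx'.1, hx.2, hx'.2, Pi.add_apply]⟩

lemma HasFracDeriv.smul {f g : X → ℂ} (h : HasFracDeriv D μ β f g) (c : ℂ) :
    HasFracDeriv D μ β (c • f) (c • g) := by
  filter_upwards [h] with x hx
  have he : (fun y => ((c • f) x - (c • f) y) / ((dyadicDist D μ x y ^ (1 + β) : ℝ) : ℂ)) =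
      fun y => c * ((f x - f y) / ((dyadicDist D μ x y ^ (1 + β) : ℝ) : ℂ)) := by
    funext y
    simp only [Pi.smul_apply, smul_eq_mul]
    ring
  rw [he]
  exact ⟨hx.1.const_mul c, by rw [integral_const_mul, hx.2, Pi.smul_apply, smul_eq_mul]⟩

/-- The graph of the fractional derivative in the product of the Besov space and `L²`. -/
def fracDerivGraph (D : ℤ → Set (Set X)) (μ : Measure X) (β σ : ℝ) :
    Submodule ℂ (Besov D μ σ × Lp ℂ 2 μ) where
  carrier := {p | HasFracDeriv D μ β p.1.toL2 p.2}
  zero_mem' := by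
    have h0 : HasFracDeriv D μ β 0 0 := .of_forall fun x => by simp
    exact h0.congr (Lp.coeFn_zero ℂ 2 μ).symm (Lp.coeFn_zero ℂ 2 μ).symm
  add_mem' {p q} hp hq := (hp.add hq).congr (Lp.coeFn_add p.1.toL2 q.1.toL2).symm
    (Lp.coeFn_add p.2 q.2).symm
  smul_mem' c p hp := (hp.smul c).congr (Lp.coeFn_smul c p.1.toL2).symm
    (Lp.coeFn_smul c p.2).symm

lemma mem_fracDerivGraph {f : Besov D μ σ} {g : Lp ℂ 2 μ} :
    (f, g) ∈ fracDerivGraph D μ β σ ↔ HasFracDeriv D μ β f.toL2 g := Iff.rfl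

lemma dyadicKernel_mul {a b : ℝ} (ha : 0 < a) (hab : 0 < a + b) (x y : X) :
    dyadicKernel D μ a x y * dyadicKernel D μ b x y = dyadicKernel D μ (a + b) x y := by
  rw [dyadicKernel, dyadicKernel, dyadicKernel, ← ENNReal.toReal_mul]
  rcases eq_or_ne (cubeDist D μ x y) 0 with h0 | h0
  · rw [h0, ENNReal.zero_rpow_of_neg (by linarith : -(a + b) < 0),
      ENNReal.zero_rpow_of_neg (by linarith : -a < 0), ENNReal.toReal_mul]
    simp
  rcases eq_or_ne (cubeDist D μ x y) ∞ with ht | ht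
  · rw [ht, ENNReal.top_rpow_of_neg (by linarith : -(a + b) < 0),
      ENNReal.top_rpow_of_neg (by linarith : -a < 0), zero_mul]
  · rw [← ENNReal.rpow_add _ _ h0 ht]
    congr 2
    ring

/-- The Cauchy-Schwarz inequality for lower integrals. -/
lemma lintegral_mul_le_sqrt_mul_sqrt {Y : Type*} [MeasurableSpace Y] {ν : Measure Y}
    {f g : Y → ℝ≥0∞} (hf : AEMeasurable f ν) (hg : AEMeasurable g ν) :
    ∫⁻ y, f y * g y ∂ν ≤
      (∫⁻ y, f y ^ (2 : ℝ) ∂ν) ^ (1 / 2 : ℝ) * (∫⁻ y, g y ^ (2 : ℝ) ∂ν) ^ (1 / 2 : ℝ) :=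
  ENNReal.lintegral_mul_le_Lp_mul_Lq ν Real.HolderConjugate.two_two hf hg

lemma Besov.lintegral_toL2_le (f : Besov D μ σ) :
    ∫⁻ x, ‖f.toL2 x‖ₑ ^ (2 : ℝ) ∂μ ≤ ‖f‖ₑ ^ (2 : ℝ) := by
  have h1 : eLpNorm f.toL2 2 μ ≤ ‖f‖ₑ := by
    rw [← ofReal_norm]
    refine ENNReal.le_ofReal_iff_toReal_le (Lp.eLpNorm_ne_top _) (norm_nonneg _) |>.2 ?_
    rw [← Lp.norm_def]
    exact f.norm_toL2_le
  have h2 := ENNReal.rpow_le_rpow h1 (show (0 : ℝ) ≤ 2 by norm_num)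
  rwa [eLpNorm_eq_lintegral_rpow_enorm_toReal (by simp) (by simp), ENNReal.toReal_ofNat,
    ← ENNReal.rpow_mul, one_div, inv_mul_cancel₀ (by norm_num), ENNReal.rpow_one] at h2

/-- Functions whose integrals are summable tend to zero almost everywhere. -/
lemma ae_tendsto_zero_of_tsum_lintegral_ne_top {Y : Type*} [MeasurableSpace Y] {ν : Measure Y}
    {u : ℕ → Y → ℝ≥0∞} (hu : ∀ n, AEMeasurable (u n) ν) (h : ∑' n, ∫⁻ y, u n y ∂ν ≠ ∞) :
    ∀ᵐ y ∂ν, Tendsto (fun n => u n y) atTop (𝓝 0) := by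
  rw [← lintegral_tsum hu] at h
  filter_upwards [ae_lt_top' (AEMeasurable.tsum hu) h] with y hy
  exact ENNReal.tendsto_atTop_zero_of_tsum_ne_top hy.ne

lemma tendsto_sqrt_zero {u : ℕ → ℝ≥0∞} (h : Tendsto u atTop (𝓝 0)) :
    Tendsto (fun n => u n ^ (1 / 2 : ℝ)) atTop (𝓝 0) := by
  have := (ENNReal.continuous_rpow_const (y := (1 / 2 : ℝ))).tendsto 0 |>.comp h
  rwa [ENNReal.zero_rpow_of_pos (by norm_num)] at this

variable [SFinite μ]

/-- The far part of the integral that defines the fractional derivative. -/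
lemma lintegral_far_le (hX : IsHomogeneousType d μ) (hD : IsDyadicFamily d μ D) (hβ : 0 < β)
    {f : X → ℂ} (hf : AEStronglyMeasurable f μ) (x : X) :
    ∫⁻ y in {y | 1 ≤ cubeDist D μ x y}, ‖(f x - f y) * dyadicKernel D μ (1 + β) x y‖ₑ ∂μ ≤
      ‖f x‖ₑ * shellConst β + eLpNorm f 2 μ * shellConst (1 + 2 * β) ^ (1 / 2 : ℝ) := by
  have hE := hD.measurable_cubeDist_right hX x
  have hν := hD.measure_cubeDist_lt x
  set A := {y | 1 ≤ cubeDist D μ x y}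
  have h1 : ∫⁻ y in A, cubeDist D μ x y ^ (-(1 + β)) ∂μ ≤ shellConst β := by
    simpa using lintegral_tail_le hν hE hβ one_ne_zero ENNReal.one_ne_top
  have h2 : ∫⁻ y in A, (cubeDist D μ x y ^ (-(1 + β))) ^ (2 : ℝ) ∂μ ≤ shellConst (1 + 2 * β) := by
    have h3 := lintegral_tail_le hν hE (show 0 < 1 + 2 * β by linarith) one_ne_zero
      ENNReal.one_ne_top
    simp_rw [← ENNReal.rpow_mul]
    rw [show -(1 + β) * 2 = -(1 + (1 + 2 * β)) by ring]
    simpa using h3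
  have h3 : (∫⁻ y in A, ‖f y‖ₑ ^ (2 : ℝ) ∂μ) ^ (1 / 2 : ℝ) ≤ eLpNorm f 2 μ := by
    rw [eLpNorm_eq_lintegral_rpow_enorm_toReal (by simp) (by simp), ENNReal.toReal_ofNat]
    exact ENNReal.rpow_le_rpow (setLIntegral_le_lintegral _ _) (by norm_num)
  calc ∫⁻ y in A, ‖(f x - f y) * dyadicKernel D μ (1 + β) x y‖ₑ ∂μ
      ≤ ∫⁻ y in A, (‖f x‖ₑ * cubeDist D μ x y ^ (-(1 + β)) +
          ‖f y‖ₑ * cubeDist D μ x y ^ (-(1 + β))) ∂μ := by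
        refine lintegral_mono fun y => ?_
        rw [enorm_mul, ← add_mul]
        refine mul_le_mul' enorm_sub_le ?_
        rw [← ofReal_norm, Complex.norm_real, ofReal_norm]
        exact enorm_dyadicKernel_le _ _ _
    _ = ‖f x‖ₑ * ∫⁻ y in A, cubeDist D μ x y ^ (-(1 + β)) ∂μ +
          ∫⁻ y in A, ‖f y‖ₑ * cubeDist D μ x y ^ (-(1 + β)) ∂μ := by
        rw [lintegral_add_left ((hE.pow_const _).const_mul _),
          lintegral_const_mul _ (hE.pow_const _)]
    _ ≤ _ := by
        refine add_le_add (mul_le_mul_right h1 _) ?_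
        refine (lintegral_mul_le_sqrt_mul_sqrt hf.enorm.restrict
          (hE.pow_const _).aemeasurable).trans ?_
        exact mul_le_mul' h3 (ENNReal.rpow_le_rpow h2 (by norm_num))

/-- The near part of the integral that defines the fractional derivative. -/
lemma lintegral_near_le (hX : IsHomogeneousType d μ) (hD : IsDyadicFamily d μ D) (hβ : 0 < β)
    (hβσ : β < σ) {f : X → ℂ} (hf : AEStronglyMeasurable f μ) (x : X) :
    ∫⁻ y in {y | 1 ≤ cubeDist D μ x y}ᶜ, ‖(f x - f y) * dyadicKernel D μ (1 + β) x y‖ₑ ∂μ ≤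
      (∫⁻ y, ‖besovQuotient D μ σ f (x, y)‖ₑ ^ (2 : ℝ) ∂μ) ^ (1 / 2 : ℝ) *
        shellConst (min (2 * (σ - β)) 1) ^ (1 / 2 : ℝ) := by
  have hE := hD.measurable_cubeDist_right hX x
  have hν := hD.measure_cubeDist_lt x
  have hA : {y | 1 ≤ cubeDist D μ x y}ᶜ = {y | cubeDist D μ x y < 1} := by
    ext y
    simp
  rw [hA]
  set A := {y | cubeDist D μ x y < 1}
  set b : ℝ := (1 + 2 * β - 2 * σ) / 2 with hb
  have hq : ∀ y, besovQuotient D μ σ f (x, y) =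
      (f x - f y) * dyadicKernel D μ ((1 + 2 * σ) / 2) x y :=
    fun y => hD.besovQuotient_eq hX σ f (x, y)
  have h2 : ∫⁻ y in A, (cubeDist D μ x y ^ (-b)) ^ (2 : ℝ) ∂μ ≤
      shellConst (min (2 * (σ - β)) 1) := by
    refine le_trans ?_ (lintegral_local_le hν hE (lt_min (by linarith) one_pos)
      (min_le_right (2 * (σ - β)) 1))
    refine setLIntegral_mono' (measurableSet_lt hE measurable_const) fun y hy => ?_
    rw [← ENNReal.rpow_mul]
    refine ENNReal.rpow_le_rpow_of_exponent_ge (le_of_lt hy) ?_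
    have := min_le_left (2 * (σ - β)) 1
    rw [hb]
    linarith
  have hm : AEMeasurable (fun y => ‖besovQuotient D μ σ f (x, y)‖ₑ) μ := by
    simp_rw [hq]
    refine ((aestronglyMeasurable_const.sub hf).mul ?_).enorm
    exact (Complex.measurable_ofReal.comp
      (hD.measurable_dyadicKernel_right hX _ x)).aestronglyMeasurable
  calc ∫⁻ y in A, ‖(f x - f y) * dyadicKernel D μ (1 + β) x y‖ₑ ∂μ
      ≤ ∫⁻ y in A, ‖besovQuotient D μ σ f (x, y)‖ₑ * cubeDist D μ x y ^ (-b) ∂μ := by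
        refine lintegral_mono fun y => ?_
        simp only [hq]
        rw [show 1 + β = (1 + 2 * σ) / 2 + b by rw [hb]; ring,
          ← dyadicKernel_mul (by linarith) (by rw [hb]; linarith), Complex.ofReal_mul, ← mul_assoc,
          enorm_mul _ ((dyadicKernel D μ b x y : ℝ) : ℂ)]
        refine mul_le_mul_right ?_ _
        rw [← ofReal_norm, Complex.norm_real, ofReal_norm]
        exact enorm_dyadicKernel_le _ _ _
    _ ≤ _ := by
        refine (lintegral_mul_le_sqrt_mul_sqrt hm.restrict (hE.pow_const _).aemeasurable).trans ?_
        exact mul_le_mul' (ENNReal.rpow_le_rpow (setLIntegral_le_lintegral _ _) (by norm_num))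
          (ENNReal.rpow_le_rpow h2 (by norm_num))

/-- Pointwise bound for the integral that defines the fractional derivative of order `β < σ`. -/
lemma exists_lintegral_fracDeriv_le (hX : IsHomogeneousType d μ) (hD : IsDyadicFamily d μ D)
    (hβ : 0 < β) (hβσ : β < σ) :
    ∃ C : ℝ≥0∞, C ≠ ∞ ∧ ∀ f : X → ℂ, AEStronglyMeasurable f μ → ∀ x,
      ∫⁻ y, ‖(f x - f y) * dyadicKernel D μ (1 + β) x y‖ₑ ∂μ ≤
        C * (‖f x‖ₑ + eLpNorm f 2 μ +
          (∫⁻ y, ‖besovQuotient D μ σ f (x, y)‖ₑ ^ (2 : ℝ) ∂μ) ^ (1 / 2 : ℝ)) := by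
  set a := shellConst β
  set b := shellConst (1 + 2 * β) ^ (1 / 2 : ℝ)
  set c := shellConst (min (2 * (σ - β)) 1) ^ (1 / 2 : ℝ)
  have ha : a ≠ ∞ := shellConst_ne_top hβ
  have hb : b ≠ ∞ := ENNReal.rpow_ne_top_of_nonneg (by norm_num)
    (shellConst_ne_top (by linarith))
  have hc : c ≠ ∞ := ENNReal.rpow_ne_top_of_nonneg (by norm_num)
    (shellConst_ne_top (lt_min (by linarith) one_pos))
  refine ⟨a + b + c, ENNReal.add_ne_top.2 ⟨ENNReal.add_ne_top.2 ⟨ha, hb⟩, hc⟩, fun f hf x => ?_⟩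
  rw [← lintegral_add_compl _ (measurableSet_le (measurable_const (a := (1 : ℝ≥0∞)))
    (hD.measurable_cubeDist_right hX x))]
  refine (add_le_add (lintegral_far_le hX hD hβ hf x)
    (lintegral_near_le hX hD hβ hβσ hf x)).trans ?_
  rw [mul_add, mul_add, mul_comm _ a, mul_comm _ b, mul_comm _ c]
  gcongr
  · exact le_add_right le_self_add
  · exact le_add_right le_add_self
  · exact le_add_self

lemma Besov.lintegral_besovQuotient_le (f : Besov D μ σ) :
    ∫⁻ x, ∫⁻ y, ‖besovQuotient D μ σ f.toL2 (x, y)‖ₑ ^ (2 : ℝ) ∂μ ∂μ ≤ ‖f‖ₑ ^ (2 : ℝ) := by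
  have hq : MemLp (besovQuotient D μ σ f.toL2) 2 (μ.prod μ) := f.2
  rw [← lintegral_prod (fun p => ‖besovQuotient D μ σ f.toL2 p‖ₑ ^ (2 : ℝ))
    (hq.aestronglyMeasurable.enorm.pow_const _)]
  have h1 : eLpNorm (besovQuotient D μ σ f.toL2) 2 (μ.prod μ) ≤ ‖f‖ₑ := by
    rw [← ofReal_norm]
    refine ENNReal.le_ofReal_iff_toReal_le hq.eLpNorm_ne_top (norm_nonneg _) |>.2 ?_
    rw [← Lp.norm_toLp _ hq]
    exact f.norm_toLp_le
  have h2 := ENNReal.rpow_le_rpow h1 (show (0 : ℝ) ≤ 2 by norm_num)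
  rwa [eLpNorm_eq_lintegral_rpow_enorm_toReal (by simp) (by simp), ENNReal.toReal_ofNat,
    ← ENNReal.rpow_mul, one_div, inv_mul_cancel₀ (by norm_num), ENNReal.rpow_one] at h2

lemma aemeasurable_lintegral_besovQuotient (f : Besov D μ σ) :
    AEMeasurable (fun x => ∫⁻ y, ‖besovQuotient D μ σ f.toL2 (x, y)‖ₑ ^ (2 : ℝ) ∂μ) μ := by
  have hq : MemLp (besovQuotient D μ σ f.toL2) 2 (μ.prod μ) := f.2
  exact (hq.aestronglyMeasurable.enorm.pow_const (2 : ℝ)).lintegral_prod_right'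

/-- For `β < σ` the fractional derivative of order `β` is closed on the Besov space: along a rapidly
convergent sequence the integrals that define it converge almost everywhere. -/
lemma isClosed_fracDerivGraph (hX : IsHomogeneousType d μ) (hD : IsDyadicFamily d μ D)
    (hβ : 0 < β) (hβσ : β < σ) :
    IsClosed (fracDerivGraph D μ β σ : Set (Besov D μ σ × Lp ℂ 2 μ)) := by
  refine IsSeqClosed.isClosed fun p p₀ hp hlim => ?_
  obtain ⟨f, g⟩ := p₀
  have hf : Tendsto (fun n => (p n).1) atTop (𝓝 f) := (continuous_fst.tendsto _).comp hlim
  have hg : Tendsto (fun n => (p n).2) atTop (𝓝 g) := (continuous_snd.tendsto _).comp hlim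
  obtain ⟨ns, hns, hg'⟩ := exists_seq_tendsto_ae_of_tendsto_Lp hg
  have hf' := hf.comp hns.tendsto_atTop
  obtain ⟨ms, hms, hfast⟩ : ∃ ms : ℕ → ℕ, StrictMono ms ∧
      ∀ n, ‖(p (ns (ms n))).1 - f‖ₑ < (2⁻¹ : ℝ≥0∞) ^ n := by
    refine extraction_forall_of_eventually
      (P := fun n k => ‖(p (ns k)).1 - f‖ₑ < (2⁻¹ : ℝ≥0∞) ^ n) fun n => ?_
    have h1 := tendsto_iff_edist_tendsto_0.1 hf'
    have h2 := h1.eventually (gt_mem_nhds (ENNReal.pow_pos (show (0 : ℝ≥0∞) < 2⁻¹ by simp) n))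
    simp only [edist_eq_enorm_sub] at h2
    exact h2
  -- from here on the sequence is the rapidly convergent subsequence
  set F : ℕ → Besov D μ σ := fun n => (p (ns (ms n))).1 with hF
  set G : ℕ → Lp ℂ 2 μ := fun n => (p (ns (ms n))).2 with hG
  have hFG : ∀ n, HasFracDeriv D μ β (F n).toL2 (G n) := fun n => hp (ns (ms n))
  set r : ℕ → Besov D μ σ := fun n => F n - f with hr
  have hsum : ∑' n, ‖r n‖ₑ ^ (2 : ℝ) ≠ ∞ := by
    have h1 : ∀ n, ‖r n‖ₑ ^ (2 : ℝ) ≤ (2⁻¹ : ℝ≥0∞) ^ n := by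
      intro n
      have h2 : ‖r n‖ₑ ≤ (2⁻¹ : ℝ≥0∞) ^ n := (hfast n).le
      have h3 : ‖r n‖ₑ ≤ 1 := h2.trans (pow_le_one₀ zero_le (by simp))
      calc ‖r n‖ₑ ^ (2 : ℝ) = ‖r n‖ₑ * ‖r n‖ₑ := by
            rw [show (2 : ℝ) = ((2 : ℕ) : ℝ) by norm_num, ENNReal.rpow_natCast, sq]
        _ ≤ 1 * (2⁻¹ : ℝ≥0∞) ^ n := mul_le_mul' h3 h2
        _ = _ := one_mul _
    refine ne_top_of_le_ne_top ?_ (ENNReal.tsum_le_tsum h1)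
    rw [ENNReal.tsum_geometric]
    simp
  have hr1 : ∀ᵐ x ∂μ, Tendsto (fun n => ‖(r n).toL2 x‖ₑ ^ (2 : ℝ)) atTop (𝓝 0) :=
    ae_tendsto_zero_of_tsum_lintegral_ne_top
      (fun n => (Lp.aestronglyMeasurable (r n).toL2).enorm.pow_const _)
      (ne_top_of_le_ne_top hsum (ENNReal.tsum_le_tsum fun n => (r n).lintegral_toL2_le))
  have hr2 : ∀ᵐ x ∂μ, Tendsto
      (fun n => ∫⁻ y, ‖besovQuotient D μ σ (r n).toL2 (x, y)‖ₑ ^ (2 : ℝ) ∂μ) atTop (𝓝 0) :=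
    ae_tendsto_zero_of_tsum_lintegral_ne_top
      (fun n => aemeasurable_lintegral_besovQuotient (r n))
      (ne_top_of_le_ne_top hsum (ENNReal.tsum_le_tsum fun n => (r n).lintegral_besovQuotient_le))
  have hr3 : Tendsto (fun n => eLpNorm (r n).toL2 2 μ) atTop (𝓝 0) := by
    have h1 : Tendsto (fun n => F n) atTop (𝓝 f) := hf'.comp hms.tendsto_atTop
    have h2 := tendsto_iff_edist_tendsto_0.1 ((Besov.continuous_toL2.tendsto f).comp h1)
    refine h2.congr fun n => ?_
    rw [edist_eq_enorm_sub, Lp.enorm_def]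
    rfl
  have hr4 : ∀ᵐ x ∂μ, ∀ n, (r n).toL2 x = (F n).toL2 x - f.toL2 x :=
    ae_all_iff.2 fun n => Lp.coeFn_sub (F n).toL2 f.toL2
  have hf2 : ∀ᵐ x ∂μ, ∫⁻ y, ‖besovQuotient D μ σ f.toL2 (x, y)‖ₑ ^ (2 : ℝ) ∂μ < ∞ :=
    ae_lt_top' (aemeasurable_lintegral_besovQuotient f)
      (ne_top_of_le_ne_top (by simp) f.lintegral_besovQuotient_le)
  obtain ⟨C, hC, hCle⟩ := exists_lintegral_fracDeriv_le hX hD hβ hβσ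
  have hFG' := ae_all_iff.2 hFG
  change HasFracDeriv D μ β f.toL2 g
  filter_upwards [hr1, hr2, hr4, hf2, hFG', hg'] with x hx1 hx2 hx4 hx5 hx6 hx7
  simp only [hD.div_dyadicDist_rpow hX] at hx6 ⊢
  have hint : Integrable (fun y => (f.toL2 x - f.toL2 y) * dyadicKernel D μ (1 + β) x y) μ := by
    refine ⟨(aestronglyMeasurable_const.sub (Lp.aestronglyMeasurable _)).mul
      (Complex.measurable_ofReal.comp
        (hD.measurable_dyadicKernel_right hX _ x)).aestronglyMeasurable, ?_⟩
    refine (hCle f.toL2 (Lp.aestronglyMeasurable _) x).trans_lt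
      (ENNReal.mul_lt_top hC.lt_top ?_)
    exact ENNReal.add_lt_top.2 ⟨ENNReal.add_lt_top.2 ⟨enorm_lt_top,
      (Lp.eLpNorm_ne_top _).lt_top⟩, ENNReal.rpow_lt_top_of_nonneg (by norm_num) hx5.ne⟩
  refine ⟨hint, ?_⟩
  refine tendsto_nhds_unique ?_ (hx7.comp hms.tendsto_atTop)
  rw [tendsto_iff_edist_tendsto_0]
  have hz : Tendsto (fun n => C * (‖(r n).toL2 x‖ₑ + eLpNorm (r n).toL2 2 μ +
      (∫⁻ y, ‖besovQuotient D μ σ (r n).toL2 (x, y)‖ₑ ^ (2 : ℝ) ∂μ) ^ (1 / 2 : ℝ))) atTop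
      (𝓝 0) := by
    have h1 : Tendsto (fun n => ‖(r n).toL2 x‖ₑ) atTop (𝓝 0) := by
      refine (tendsto_sqrt_zero hx1).congr fun n => ?_
      rw [← ENNReal.rpow_mul]
      norm_num
    have h2 := ENNReal.Tendsto.const_mul ((h1.add hr3).add (tendsto_sqrt_zero hx2))
      (Or.inr hC)
    simpa using h2
  refine tendsto_of_tendsto_of_tendsto_of_le_of_le tendsto_const_nhds hz (fun _ => zero_le)
    fun n => ?_
  refine le_trans ?_ (hCle (r n).toL2 (Lp.aestronglyMeasurable _) x)
  change edist (G n x) _ ≤ _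
  rw [← (hx6 n).2, edist_eq_enorm_sub, ← integral_sub (hx6 n).1 hint]
  refine (enorm_integral_le_lintegral_enorm _).trans (le_of_eq (lintegral_congr_ae ?_))
  filter_upwards [hr4] with y hy
  rw [hy n, hx4 n]
  congr 1
  ring

namespace HaarSystem

lemma hasFracDeriv (hX : IsHomogeneousType d μ) (hD : IsDyadicFamily d μ D) (H : HaarSystem D μ)
    (hβ : 0 < β) (h : H.carrier) :
    HasFracDeriv D μ β (fun x => (h.1 x : ℂ))
      fun x => ((dyadicEigenvalue D μ β (H.cube h) * h.1 x : ℝ) : ℂ) := by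
  refine .of_forall fun x => ?_
  have hw := H.isWavelet h
  simp only [hD.div_dyadicDist_rpow hX _ fun x => (h.1 x : ℂ)]
  refine ⟨hw.integrable_sub_mul_kernel hX hD hβ x, ?_⟩
  rw [hw.integral_sub_mul_kernel hX hD hβ x, Complex.ofReal_mul]

/-- The fractional derivative acts on Haar series term by term. -/
lemma hasFracDeriv_of_hasSum (hX : IsHomogeneousType d μ) (hD : IsDyadicFamily d μ D)
    (H : HaarSystem D μ) (hβ : 0 < β) (hσ : 0 < σ) (hβσ : β < σ) {a : H.carrier → ℂ}
    {f : Besov D μ σ} {g : Lp ℂ 2 μ} (hf : HasSum (fun h => a h • H.toBesov hX hD hσ h) f)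
    (hg : HasSum (fun h => (a h * dyadicEigenvalue D μ β (H.cube h)) • H.toL2 h) g) :
    HasFracDeriv D μ β f.toL2 g := by
  rw [← mem_fracDerivGraph (σ := σ)]
  have hfg := hf.prodMk hg
  refine (isClosed_fracDerivGraph hX hD hβ hβσ).mem_of_tendsto hfg (.of_forall fun s => ?_)
  refine Submodule.sum_mem _ fun h _ => ?_
  rw [mul_smul, ← Prod.smul_mk]
  refine Submodule.smul_mem _ _ ?_
  rw [mem_fracDerivGraph]
  refine (H.hasFracDeriv hX hD hβ h).congr (H.coeFn_toL2 h).symm ?_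
  filter_upwards [Lp.coeFn_smul (dyadicEigenvalue D μ β (H.cube h) : ℂ) (H.toL2 h),
    H.coeFn_toL2 h] with x h1 h2
  rw [h1, Pi.smul_apply, h2, smul_eq_mul, Complex.ofReal_mul]

end HaarSystem

end FracDeriv

/-! ### The Schrödinger equation -/

section Schrodinger

variable {X : Type*} [MeasurableSpace X] {d : X → X → ℝ} {μ : Measure X} {D : ℤ → Set (Set X)}

lemma rpow_neg_le_one_add {s a b : ℝ} (hs : 0 < s) (hb : 0 ≤ b) (hba : b ≤ a) :
    s ^ (-b) ≤ 1 + s ^ (-a) := by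
  rcases le_total s 1 with h | h
  · exact (Real.rpow_le_rpow_of_exponent_ge hs h (neg_le_neg hba)).trans
      (le_add_of_nonneg_left zero_le_one)
  · exact (Real.rpow_le_one_of_one_le_of_nonpos h (by linarith)).trans
      (le_add_of_nonneg_right (Real.rpow_nonneg hs.le _))

/-- A derivative of order `β` costs the regularity `β`, in terms of the weights with which the Haar
coefficients enter the squares of the Besov norms. -/
lemma IsDyadicFamily.exists_weight_le [SFinite μ] (hX : IsHomogeneousType d μ)
    (hD : IsDyadicFamily d μ D) {β lam : ℝ} (hβ : 0 < β) (hlam : β < lam) :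
    ∃ C : ℝ, ∀ j, ∀ Q ∈ D j,
      (1 + dyadicEigenvalue D μ β Q ^ 2) * (1 + 2 * dyadicEigenvalue D μ (2 * (lam - β)) Q) ≤
        C * (1 + 2 * dyadicEigenvalue D μ (2 * lam) Q) := by
  set A := 1 + (shellConst β).toReal
  set B := 1 + (shellConst (2 * (lam - β))).toReal
  have hA : 0 < A := by positivity
  have hB : 0 < B := by positivity
  refine ⟨1 + 2 * B + A ^ 2 + 2 * A ^ 2 * B, fun j Q hQ => ?_⟩
  have hs := hD.real_pos hX hQ
  set s := μ.real Q
  have h1 : dyadicEigenvalue D μ β Q ≤ A * s ^ (-β) := hD.dyadicEigenvalue_le hX hβ hQ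
  have h2 : dyadicEigenvalue D μ (2 * (lam - β)) Q ≤ B * s ^ (-(2 * (lam - β))) :=
    hD.dyadicEigenvalue_le hX (by linarith) hQ
  have h3 : s ^ (-(2 * lam)) ≤ dyadicEigenvalue D μ (2 * lam) Q :=
    hD.rpow_le_dyadicEigenvalue hX _ hQ
  have p1 := hD.dyadicEigenvalue_pos hX β hQ
  have p2 := hD.dyadicEigenvalue_pos hX (2 * (lam - β)) hQ
  have e1 : (s ^ (-β)) ^ 2 = s ^ (-(2 * β)) := by
    rw [← Real.rpow_natCast, ← Real.rpow_mul hs.le]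
    congr 1
    push_cast
    ring
  have e2 : s ^ (-(2 * β)) * s ^ (-(2 * (lam - β))) = s ^ (-(2 * lam)) := by
    rw [← Real.rpow_add hs]
    congr 1
    ring
  have h4 : dyadicEigenvalue D μ β Q ^ 2 ≤ A ^ 2 * s ^ (-(2 * β)) := by
    rw [← e1, ← mul_pow]
    exact pow_le_pow_left₀ p1.le h1 2
  have h5 : s ^ (-(2 * β)) ≤ 1 + s ^ (-(2 * lam)) :=
    rpow_neg_le_one_add hs (by linarith) (by linarith)
  have h6 : s ^ (-(2 * (lam - β))) ≤ 1 + s ^ (-(2 * lam)) :=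
    rpow_neg_le_one_add hs (by linarith) (by linarith)
  have q1 : 0 < s ^ (-(2 * β)) := Real.rpow_pos_of_pos hs _
  have q2 : 0 < s ^ (-(2 * (lam - β))) := Real.rpow_pos_of_pos hs _
  have q3 : 0 < s ^ (-(2 * lam)) := Real.rpow_pos_of_pos hs _
  calc _ ≤ (1 + A ^ 2 * s ^ (-(2 * β))) * (1 + 2 * (B * s ^ (-(2 * (lam - β))))) := by
        gcongr
    _ = 1 + 2 * B * s ^ (-(2 * (lam - β))) + A ^ 2 * s ^ (-(2 * β)) +
          2 * A ^ 2 * B * s ^ (-(2 * lam)) := by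
        rw [← e2]
        ring
    _ ≤ (1 + s ^ (-(2 * lam))) + 2 * B * (1 + s ^ (-(2 * lam))) +
          A ^ 2 * (1 + s ^ (-(2 * lam))) + 2 * A ^ 2 * B * (1 + s ^ (-(2 * lam))) := by
        gcongr
        · linarith
        · linarith
    _ = (1 + 2 * B + A ^ 2 + 2 * A ^ 2 * B) * (1 + s ^ (-(2 * lam))) := by ring
    _ ≤ _ := by
        gcongr
        linarith

/-- The factor `e^{-itω}` of a solution of the Schrödinger equation. -/
noncomputable def phase (ω t : ℝ) : ℂ := Complex.exp (-Complex.I * ((t * ω : ℝ) : ℂ))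

lemma norm_phase (ω t : ℝ) : ‖phase ω t‖ = 1 := by
  rw [phase, show -Complex.I * ((t * ω : ℝ) : ℂ) = ((-(t * ω) : ℝ) : ℂ) * Complex.I by
    push_cast; ring]
  exact Complex.norm_exp_ofReal_mul_I _

lemma hasDerivAt_phase (ω t : ℝ) :
    HasDerivAt (phase ω) (-Complex.I * (ω : ℂ) * phase ω t) t := by
  have h1 : HasDerivAt (fun t : ℝ => ((t * ω : ℝ) : ℂ)) ((1 * ω : ℝ) : ℂ) t :=
    ((hasDerivAt_id t).mul_const ω).ofReal_comp
  have h2 := (h1.const_mul (-Complex.I)).cexp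
  refine h2.congr_deriv ?_
  rw [phase]
  push_cast
  ring

lemma norm_phase_sub_le {ω : ℝ} (hω : 0 ≤ ω) (s t : ℝ) :
    ‖phase ω s - phase ω t‖ ≤ ω * |s - t| := by
  have h := Convex.norm_image_sub_le_of_norm_hasDerivWithin_le (f := phase ω) (C := ω)
    (fun x _ => (hasDerivAt_phase ω x).hasDerivWithinAt) (fun x _ => by
      rw [norm_mul, norm_phase, norm_mul, norm_neg, Complex.norm_I, Complex.norm_real,
        Real.norm_of_nonneg hω, one_mul, mul_one]) convex_univ (Set.mem_univ t) (Set.mem_univ s)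
  simpa using h

namespace HaarSystem

lemma hasSum_smul_toL2 [SFinite μ] {hX : IsHomogeneousType d μ} {hD : IsDyadicFamily d μ D}
    {H : HaarSystem D μ} {σ : ℝ} {hσ : 0 < σ} {a : H.carrier → ℂ} {f : Besov D μ σ}
    (hf : HasSum (fun h => a h • H.toBesov hX hD hσ h) f) :
    HasSum (fun h => a h • H.toL2 h) f.toL2 :=
  (Besov.hasSum_toL2 hf).congr_fun fun h => by rw [Besov.toL2_smul, toL2_toBesov]

/-- A Haar series with phases is differentiable in time, term by term. -/
lemma hasDerivAt_of_hasSum [SFinite μ] (hX : IsHomogeneousType d μ) (hD : IsDyadicFamily d μ D)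
    (H : HaarSystem D μ) {σ : ℝ} (hσ : 0 < σ) {c : H.carrier → ℂ} {ω : H.carrier → ℝ}
    (hω : ∀ h, 0 ≤ ω h)
    (hc : Summable fun h =>
      (ω h * ‖c h‖) ^ 2 * (1 + 2 * dyadicEigenvalue D μ (2 * σ) (H.cube h)))
    {w : ℝ → Besov D μ σ} {v : Besov D μ σ} {t : ℝ}
    (hw : ∀ s, HasSum (fun h => (phase (ω h) s * c h) • H.toBesov hX hD hσ h) (w s))
    (hv : HasSum (fun h => (-Complex.I * ω h * phase (ω h) t * c h) • H.toBesov hX hD hσ h) v) :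
    HasDerivAt w v t := by
  rw [hasDerivAt_iff_tendsto_slope_zero]
  refine H.tendsto_besov_of_hasSum hX hD hσ (B := fun h => 2 * (ω h * ‖c h‖))
    (a := fun (s : ℝ) h => (s : ℂ)⁻¹ * (phase (ω h) (t + s) * c h - phase (ω h) t * c h))
    (.of_forall fun s => ?_) hv ?_ ?_ fun h => ?_
  · have h1 := ((hw (t + s)).sub (hw t)).const_smul ((s : ℂ)⁻¹)
    rw [← Complex.ofReal_inv, Complex.coe_smul] at h1
    refine h1.congr_fun fun h => ?_
    rw [← sub_smul, smul_smul, Complex.ofReal_inv]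
  · refine (hc.mul_left 4).congr fun h => ?_
    ring
  · filter_upwards [self_mem_nhdsWithin] with s hs h
    have hs : s ≠ 0 := hs
    refine (norm_sub_le _ _).trans ?_
    rw [two_mul]
    refine add_le_add ?_ (le_of_eq ?_)
    · have h1 := norm_phase_sub_le (hω h) (t + s) t
      rw [add_sub_cancel_left] at h1
      rw [← sub_mul, ← mul_assoc, norm_mul, norm_mul, norm_inv, Complex.norm_real,
        Real.norm_eq_abs]
      refine mul_le_mul_of_nonneg_right ?_ (norm_nonneg _)
      rw [inv_mul_le_iff₀ (abs_pos.2 hs)]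
      linarith
    · rw [norm_mul, norm_mul, norm_mul, norm_neg, Complex.norm_I, norm_phase, Complex.norm_real,
        Real.norm_of_nonneg (hω h), one_mul, mul_one]
  · have h1 := hasDerivAt_iff_tendsto_slope_zero.1 ((hasDerivAt_phase (ω h) t).mul_const (c h))
    refine h1.congr fun s => ?_
    rw [← Complex.coe_smul, Complex.ofReal_inv, smul_eq_mul]

end HaarSystem

end Schrodinger

theorem theorem1 {X : Type*} [MeasurableSpace X] (d : X → X → ℝ) (μ : Measure X)
    (hX : IsHomogeneousType d μ) (D : ℤ → Set (Set X)) (hD : IsDyadicFamily d μ D)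
    (hquad : IsQuadrant D) (H : HaarSystem D μ) (β : ℝ) (hβ0 : 0 < β) (hβ1 : β < 1) :
    -- the constants `m_h`, determined by `D^β h = m_h μ(Q(h))^{-β} h`
    ∃ m : H.carrier → ℝ,
      (∀ h : H.carrier, HasFracDeriv D μ β (fun x => (h.1 x : ℂ))
        (fun x => ((m h * μ.real (H.cube h) ^ (-β) * h.1 x : ℝ) : ℂ))) ∧
      (∃ M₁ M₂ : ℝ, 0 < M₁ ∧ ∀ h, M₁ < m h ∧ m h < M₂) ∧
      ∀ lam : ℝ, β < lam → lam < 1 →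
      ∀ u₀ : Besov D μ lam,
        -- `P₀ u₀ = 0`, with `P₀` the orthogonal projection of `L²` onto `V₀`
        u₀.toL2 ∈ (dyadicConst D μ 0)ᗮ →
        ∃ u : ℝ → Besov D μ lam,
          -- `u(t)` is the sum of the series, in `L²`
          (∀ t : ℝ, 0 < t → HasSum
            (fun h : H.carrier =>
              (Complex.exp (-Complex.I * ((t * m h * μ.real (H.cube h) ^ (-β) : ℝ) : ℂ)) *
                inner ℂ (H.toL2 h) u₀.toL2) • H.toL2 h)
            (u t).toL2) ∧
          -- `u` as a function with values in `B^{λ-β}_2`, and its derivative `v` there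
          (∃ w v : ℝ → Besov D μ (lam - β), ∀ t : ℝ, 0 < t →
            (w t).toL2 = (u t).toL2 ∧
            HasDerivAt w (v t) t ∧
            HasFracDeriv D μ β (u t).toL2 (fun x => Complex.I * (v t).toL2 x)) ∧
          Tendsto u (𝓝[>] 0) (𝓝 u₀) := by
  have := hD.sigmaFinite hX hquad
  -- `ω h` is the eigenvalue of `D^β` on `h`, so `m h = ω h * μ(Q(h))^β`
  set ω : H.carrier → ℝ := fun h => dyadicEigenvalue D μ β (H.cube h) with hω
  have hω0 : ∀ h, 0 ≤ ω h := fun h => (hD.dyadicEigenvalue_pos hX β (H.cube_mem h)).le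
  have hmω : ∀ h, ω h * μ.real (H.cube h) ^ β * μ.real (H.cube h) ^ (-β) = ω h := by
    intro h
    rw [mul_assoc, ← Real.rpow_add (hD.real_pos hX (H.cube_mem h)), add_neg_cancel,
      Real.rpow_zero, mul_one]
  refine ⟨fun h => ω h * μ.real (H.cube h) ^ β, fun h => ?_,
    ⟨1 / 2, 2 + (shellConst β).toReal, by norm_num, fun h => ?_⟩, fun lam hlam _ u₀ hu₀ => ?_⟩
  · simp only [hmω]
    exact H.hasFracDeriv hX hD hβ0 h
  · have hs := Real.rpow_pos_of_pos (hD.real_pos hX (H.cube_mem h)) β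
    have e : μ.real (H.cube h) ^ (-β) * μ.real (H.cube h) ^ β = 1 := by
      rw [← Real.rpow_add (hD.real_pos hX (H.cube_mem h)), neg_add_cancel, Real.rpow_zero]
    have h1 := mul_le_mul_of_nonneg_right
      (hD.rpow_le_dyadicEigenvalue hX β (H.cube_mem h)) hs.le
    have h2 := mul_le_mul_of_nonneg_right (hD.dyadicEigenvalue_le hX hβ0 (H.cube_mem h)) hs.le
    rw [e] at h1
    rw [mul_assoc, e, mul_one] at h2
    exact ⟨by linarith, by linarith⟩
  · have hl0 : 0 < lam := hβ0.trans hlam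
    have hl1 : 0 < lam - β := sub_pos.2 hlam
    set c : H.carrier → ℂ := fun h => inner ℂ (H.toL2 h) u₀.toL2 with hc
    have hphase : ∀ t h, Complex.exp (-Complex.I * ((t * (ω h * μ.real (H.cube h) ^ β) *
        μ.real (H.cube h) ^ (-β) : ℝ) : ℂ)) = phase (ω h) t := by
      intro t h
      rw [mul_assoc, hmω, phase]
    -- square summability of the coefficients with the weights of `B^λ` and `B^{λ-β}`
    have hs0 : Summable fun h =>
        ‖c h‖ ^ 2 * (1 + 2 * dyadicEigenvalue D μ (2 * lam) (H.cube h)) :=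
      H.summable_weight_mul_inner_sq hX hD hl0 u₀
    obtain ⟨C, hC⟩ := hD.exists_weight_le hX hβ0 hlam
    have hs1 : Summable fun h => ‖c h‖ ^ 2 * ((1 + ω h ^ 2) *
        (1 + 2 * dyadicEigenvalue D μ (2 * (lam - β)) (H.cube h))) := by
      refine Summable.of_nonneg_of_le (fun h => ?_) (fun h => ?_) (hs0.mul_left C)
      · have := H.weight_pos hX hD (σ := lam - β) h
        positivity
      · have := mul_le_mul_of_nonneg_left (hC _ _ (H.cube_mem h)) (sq_nonneg ‖c h‖)
        linarith
    have hs2 : Summable fun h =>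
        ‖c h‖ ^ 2 * (1 + 2 * dyadicEigenvalue D μ (2 * (lam - β)) (H.cube h)) := by
      refine Summable.of_nonneg_of_le (fun h => ?_) (fun h => ?_) hs1
      · have := H.weight_pos hX hD (σ := lam - β) h
        positivity
      · have := H.weight_pos hX hD (σ := lam - β) h
        refine mul_le_mul_of_nonneg_left ?_ (sq_nonneg _)
        exact le_mul_of_one_le_left this.le (by nlinarith [sq_nonneg (ω h)])
    have hs3 : Summable fun h => (ω h * ‖c h‖) ^ 2 *
        (1 + 2 * dyadicEigenvalue D μ (2 * (lam - β)) (H.cube h)) := by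
      refine (hs1.sub hs2).congr fun h => ?_
      ring
    -- the same series, summed in `B^λ` (`u`) and in `B^{λ-β}` (`w`), and its derivative (`v`)
    have hu : ∀ t : ℝ, ∃ f : Besov D μ lam,
        HasSum (fun h => (phase (ω h) t * c h) • H.toBesov hX hD hl0 h) f := fun t =>
      H.exists_hasSum_besov hX hD hl0 (by simpa [norm_mul, norm_phase] using hs0)
    have hw : ∀ t : ℝ, ∃ f : Besov D μ (lam - β),
        HasSum (fun h => (phase (ω h) t * c h) • H.toBesov hX hD hl1 h) f := fun t =>
      H.exists_hasSum_besov hX hD hl1 (by simpa [norm_mul, norm_phase] using hs2)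
    have hv : ∀ t : ℝ, ∃ f : Besov D μ (lam - β), HasSum (fun h =>
        (-Complex.I * ω h * phase (ω h) t * c h) • H.toBesov hX hD hl1 h) f := fun t =>
      H.exists_hasSum_besov hX hD hl1 (by simpa [norm_mul, norm_phase, mul_pow] using hs3)
    choose u hu using hu
    choose w hw using hw
    choose v hv using hv
    have hu2 : ∀ t, HasSum (fun h => (phase (ω h) t * c h) • H.toL2 h) (u t).toL2 := fun t =>
      HaarSystem.hasSum_smul_toL2 (hu t)
    refine ⟨u, fun t _ => ?_, ⟨w, v, fun t _ => ⟨?_, ?_, ?_⟩⟩, ?_⟩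
    · refine (hu2 t).congr_fun fun h => ?_
      beta_reduce
      rw [hphase]
    · exact (HaarSystem.hasSum_smul_toL2 (hw t)).unique (hu2 t)
    · exact H.hasDerivAt_of_hasSum hX hD hl1 hω0 hs3 hw (hv t)
    · have h1 : HasSum (fun h => (phase (ω h) t * c h * ω h) • H.toL2 h)
          (Complex.I • (v t).toL2) := by
        have h2 : HasSum (fun h => (-Complex.I * ω h * phase (ω h) t * c h) • H.toL2 h)
          (v t).toL2 := HaarSystem.hasSum_smul_toL2 (hv t)
        refine (h2.const_smul Complex.I).congr_fun fun h => ?_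
        rw [smul_smul]
        congr 1
        linear_combination ((ω h : ℂ) * phase (ω h) t * c h) * Complex.I_mul_I
      exact (H.hasFracDeriv_of_hasSum hX hD hβ0 hl0 hlam (hu t) h1).congr (ae_eq_refl _)
        (Lp.coeFn_smul _ _)
    · -- by completeness of the Haar system the series at time `0` is that of `u₀`
      have h0 : HasSum (fun h => c h • H.toBesov hX hD hl0 h) u₀ := by
        obtain ⟨f, hf⟩ := H.exists_hasSum_besov hX hD hl0 hs0
        have hfu : f = u₀ := Besov.toL2_injective
          ((HaarSystem.hasSum_smul_toL2 hf).unique (H.hasSum_inner_smul_toL2 hX hD hu₀))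
        rwa [← hfu]
      refine H.tendsto_besov_of_hasSum hX hD hl0 (B := fun h => 2 * ‖c h‖)
        (.of_forall hu) h0 ?_ (.of_forall fun t h => ?_) fun h => ?_
      · refine (hs0.mul_left 4).congr fun h => ?_
        ring
      · refine (norm_sub_le _ _).trans (le_of_eq ?_)
        rw [norm_mul, norm_phase, one_mul, two_mul]
      · have h1 := ((hasDerivAt_phase (ω h) 0).continuousAt.tendsto.mul_const (c h)).mono_left
          (nhdsWithin_le_nhds (s := Set.Ioi 0))
        simpa [phase] using h1
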